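/- Let $n \ge 0$. Let $X,Z,S,H$ be the usual one-qubit gates, $H=\frac{1}{\sqrt2}\begin{pmatrix}1&1\\1&-1\end{pmatrix}$, $S=\mathrm{diag}(1,i)$, and let $CNOT_{i\to j}$, $CZ_{i,j}$ be the usual two-qubit gates. The $n$-qubit Clifford group is the group of unitaries on $n$ qubits generated by the gates $H$, $S$ and $CNOT$, and an $n$-qubit stabilizer state is a state of the form $U|0^n\rangle$ with $U$ in the Clifford group. States are considered up to global phase. Consider the following randomized algorithm, in which all random choices are independent given the earlier ones. 1. Initialize the state to $|0^n\rangle$. 2. Sample $d\in\{0,1,\dots,n\}$ with probability $P(d)=\eta(d)/\sum_{m=0}^n\eta(m)$, where $$\eta(d)=2^{-d(d+1)/2}\prod_{a=1}^{d}\frac{1-2^{d-n-a}}{1-2^{-a}},\qquad \eta(0)=1,$$ and put $k=n-d$. 3. Sample a uniformly random $k$-dimensional linear subspace $V$ of $\mathbb F_2^n$. Let $M\in\mathbb F_2^{k\times n}$ be the generator matrix of $V$ in reduced row echelon form and let $\mathcal T\subseteq\{1,\dots,n\}$ be its set of pivot columns, so $|\mathcal T|=k$. 4. Apply $H$ to every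 qubit in $\mathcal T$. 5. For every $i\in\mathcal T$ and every $j>i$ such that the row of $M$ with pivot column $i$ has a $1$ in column $j$, apply $CNOT_{i\to j}$ (control $i$, target $j$). 6. Apply $X$ to each qubit outside $\mathcal T$, independently with probability $1/2$. 7. Apply $S$ to each qubit in $\mathcal T$, independently with probability $1/2$. 8. Apply $Z$ to each qubit in $\mathcal T$, independently with probability $1/2$. 9. Apply $CZ$ to each unordered pair of distinct qubits in $\mathcal T$, independently with probability $1/2$. **Theorem.** The set of $n$-qubit stabilizer states (up to global phase) is finite, and the output of this algorithm is a uniformly random $n$-qubit stabilizer state: its distribution is the uniform distribution on that set. -/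

import Mathlib

namespace RandomStab

/-! ### Qubits, gates, the Clifford group and stabilizer states -/

/-- Labels of the computational basis of `n` qubits: bit strings, seen as vectors of `𝔽₂ⁿ`. -/
abbrev Bits (n : ℕ) : Type := Fin n → ZMod 2

/-- Unitary operators on `n` qubits, as matrices in the computational basis. -/
abbrev Op (n : ℕ) : Type := Matrix.unitaryGroup (Bits n) ℂ

/-- The pure states of `n` qubits: state vectors up to a nonzero scalar. For unit vectors this is
the identification of state vectors that differ by a global phase. -/
abbrev PureState (n : ℕ) : Type := Projectivization ℂ (Bits n → ℂ)

/-- The matrix of `A ⊗ 1`, with the one-qubit operator `A` acting on qubit `i`. -/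
def onQubit {n : ℕ} (i : Fin n) (A : Matrix (ZMod 2) (ZMod 2) ℂ) :
    Matrix (Bits n) (Bits n) ℂ :=
  Matrix.of fun x y => if ∀ j, j ≠ i → x j = y j then A (x i) (y i) else 0

noncomputable def matX : Matrix (ZMod 2) (ZMod 2) ℂ := !![0, 1; 1, 0]
noncomputable def matZ : Matrix (ZMod 2) (ZMod 2) ℂ := !![1, 0; 0, -1]
noncomputable def matS : Matrix (ZMod 2) (ZMod 2) ℂ := !![1, 0; 0, Complex.I]
noncomputable def matH : Matrix (ZMod 2) (ZMod 2) ℂ :=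
  !![1 / (Real.sqrt 2 : ℂ), 1 / (Real.sqrt 2 : ℂ); 1 / (Real.sqrt 2 : ℂ), -1 / (Real.sqrt 2 : ℂ)]

theorem onQubit_one {n : ℕ} (i : Fin n) : onQubit i 1 = 1 := by
  ext x y
  simp only [onQubit, Matrix.of_apply, Matrix.one_apply]
  by_cases h : x = y
  · simp [h]
  · rw [if_neg h]
    split_ifs with h1 h2
    · exact absurd (funext fun j => if hj : j = i then hj ▸ h2 else h1 j hj) h
    · rfl
    · rfl

theorem onQubit_mul {n : ℕ} (i : Fin n) (A B : Matrix (ZMod 2) (ZMod 2) ℂ) :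
    onQubit i A * onQubit i B = onQubit i (A * B) := by
  ext x y
  simp only [onQubit, Matrix.mul_apply, Matrix.of_apply]
  split_ifs with h
  · symm
    refine Finset.sum_of_injOn (fun b => Function.update y i b) ?_ ?_ ?_ ?_
    · intro b _ c _ hbc
      simpa using congrFun hbc i
    · intro b _
      simp
    · intro z _ hz
      rw [if_neg (c := ∀ j, j ≠ i → z j = y j), mul_zero]
      intro hzy
      refine hz ⟨z i, by simp, ?_⟩
      funext j
      by_cases hj : j = i
      · subst hj; simp
      · simp [hj, hzy j hj]
    · intro b _
      have h1 : ∀ j, j ≠ i → x j = Function.update y i b j := fun j hj => by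
        simp [hj, h j hj]
      have h2 : ∀ j, j ≠ i → Function.update y i b j = y j := fun j hj => by simp [hj]
      rw [if_pos h1, if_pos h2]
      simp
  · refine Finset.sum_eq_zero fun z _ => ?_
    by_cases h1 : ∀ j, j ≠ i → x j = z j
    · rw [if_neg (c := ∀ j, j ≠ i → z j = y j), mul_zero]
      exact fun h2 => h fun j hj => (h1 j hj).trans (h2 j hj)
    · rw [if_neg h1, zero_mul]

theorem onQubit_star {n : ℕ} (i : Fin n) (A : Matrix (ZMod 2) (ZMod 2) ℂ) :
    star (onQubit i A) = onQubit i (star A) := by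
  ext x y
  simp only [onQubit, Matrix.star_apply, Matrix.of_apply]
  have : (∀ j, j ≠ i → y j = x j) ↔ (∀ j, j ≠ i → x j = y j) :=
    forall_congr' fun j => forall_congr' fun _ => eq_comm
  by_cases h : ∀ j, j ≠ i → x j = y j
  · rw [if_pos h, if_pos (this.2 h)]
  · rw [if_neg h, if_neg (fun h' => h (this.1 h')), star_zero]

theorem onQubit_mem {n : ℕ} (i : Fin n) {A : Matrix (ZMod 2) (ZMod 2) ℂ}
    (hA : A ∈ Matrix.unitaryGroup (ZMod 2) ℂ) :
    onQubit i A ∈ Matrix.unitaryGroup (Bits n) ℂ := by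
  rw [Matrix.mem_unitaryGroup_iff] at hA ⊢
  rw [onQubit_star, onQubit_mul, hA, onQubit_one]

theorem matX_mem : matX ∈ Matrix.unitaryGroup (ZMod 2) ℂ := by
  rw [Matrix.mem_unitaryGroup_iff]
  change (_ : Matrix (Fin 2) (Fin 2) ℂ) * star (_ : Matrix (Fin 2) (Fin 2) ℂ) = 1
  ext a b
  fin_cases a <;> fin_cases b <;> simp [matX, Matrix.mul_apply, Fin.sum_univ_two]

theorem matZ_mem : matZ ∈ Matrix.unitaryGroup (ZMod 2) ℂ := by
  rw [Matrix.mem_unitaryGroup_iff]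
  change (_ : Matrix (Fin 2) (Fin 2) ℂ) * star (_ : Matrix (Fin 2) (Fin 2) ℂ) = 1
  ext a b
  fin_cases a <;> fin_cases b <;> simp [matZ, Matrix.mul_apply, Fin.sum_univ_two]

theorem matS_mem : matS ∈ Matrix.unitaryGroup (ZMod 2) ℂ := by
  rw [Matrix.mem_unitaryGroup_iff]
  change (_ : Matrix (Fin 2) (Fin 2) ℂ) * star (_ : Matrix (Fin 2) (Fin 2) ℂ) = 1
  ext a b
  fin_cases a <;> fin_cases b <;> simp [matS, Matrix.mul_apply, Fin.sum_univ_two]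

theorem matH_mem : matH ∈ Matrix.unitaryGroup (ZMod 2) ℂ := by
  have h2 : ((Real.sqrt 2 : ℝ) : ℂ)⁻¹ * ((Real.sqrt 2 : ℝ) : ℂ)⁻¹ = 1 / 2 := by
    rw [← mul_inv, ← Complex.ofReal_mul, Real.mul_self_sqrt (by norm_num)]
    norm_num
  rw [Matrix.mem_unitaryGroup_iff]
  change (_ : Matrix (Fin 2) (Fin 2) ℂ) * star (_ : Matrix (Fin 2) (Fin 2) ℂ) = 1
  ext a b
  fin_cases a <;> fin_cases b <;>
    simp [matH, Matrix.mul_apply, Fin.sum_univ_two, h2, neg_div] <;> norm_num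

noncomputable def gateX {n : ℕ} (i : Fin n) : Op n := ⟨onQubit i matX, onQubit_mem i matX_mem⟩
noncomputable def gateZ {n : ℕ} (i : Fin n) : Op n := ⟨onQubit i matZ, onQubit_mem i matZ_mem⟩
noncomputable def gateS {n : ℕ} (i : Fin n) : Op n := ⟨onQubit i matS, onQubit_mem i matS_mem⟩
noncomputable def gateH {n : ℕ} (i : Fin n) : Op n := ⟨onQubit i matH, onQubit_mem i matH_mem⟩

/-- The matrix of `CNOT` with control `i` and target `j`: it sends `|y⟩` to `|x⟩`, where `x` is `y`
with `y i` added to the bit `j`. -/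
noncomputable def matCNOT {n : ℕ} (i j : Fin n) : Matrix (Bits n) (Bits n) ℂ :=
  Matrix.of fun x y => if x = Function.update y j (y j + y i) then 1 else 0

/-- The matrix of `CZ` on the qubits `i` and `j`: it multiplies `|x⟩` by `-1` if the bits `i` and
`j` of `x` are both `1`. -/
noncomputable def matCZ {n : ℕ} (i j : Fin n) : Matrix (Bits n) (Bits n) ℂ :=
  Matrix.diagonal fun x => if x i = 1 ∧ x j = 1 then -1 else 1

theorem cnot_invol {n : ℕ} {i j : Fin n} (h : i ≠ j) (y : Bits n) :
    Function.update (Function.update y j (y j + y i)) j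
      (Function.update y j (y j + y i) j + Function.update y j (y j + y i) i) = y := by
  funext k
  by_cases hk : k = j
  · subst hk
    simp [h, add_assoc, CharTwo.add_self_eq_zero]
  · simp [hk]

theorem matCNOT_mem {n : ℕ} {i j : Fin n} (h : i ≠ j) :
    matCNOT i j ∈ Matrix.unitaryGroup (Bits n) ℂ := by
  rw [Matrix.mem_unitaryGroup_iff']
  ext x y
  simp only [matCNOT, Matrix.mul_apply, Matrix.star_apply, Matrix.of_apply, Matrix.one_apply]
  simp only [mul_ite, mul_one, mul_zero, Finset.sum_ite_eq', Finset.mem_univ,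
    if_true]
  by_cases hxy : x = y
  · simp [hxy]
  · rw [if_neg hxy, if_neg, star_zero]
    intro he
    apply hxy
    rw [← cnot_invol h x, ← he, cnot_invol h y]

theorem matCZ_mem {n : ℕ} (i j : Fin n) : matCZ i j ∈ Matrix.unitaryGroup (Bits n) ℂ := by
  rw [Matrix.mem_unitaryGroup_iff, matCZ, Matrix.star_eq_conjTranspose,
    Matrix.diagonal_conjTranspose, Matrix.diagonal_mul_diagonal, ← Matrix.diagonal_one]
  congr 1
  funext x
  by_cases hx : x i = 1 ∧ x j = 1 <;> simp [hx]

noncomputable def gateCNOT {n : ℕ} (i j : Fin n) (h : i ≠ j) : Op n :=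
  ⟨matCNOT i j, matCNOT_mem h⟩
noncomputable def gateCZ {n : ℕ} (i j : Fin n) : Op n := ⟨matCZ i j, matCZ_mem i j⟩

/-- The group of `n`-qubit unitary operators generated by the gates `H`, `S` and `CNOT`. -/
def cliffordGroup (n : ℕ) : Subgroup (Op n) :=
  Subgroup.closure
    ({U | ∃ i, U = gateH i} ∪ {U | ∃ i, U = gateS i} ∪ {U | ∃ i j h, U = gateCNOT i j h})

/-- The state vector `|0ⁿ⟩`. -/
noncomputable def ketZero (n : ℕ) : Bits n → ℂ := Pi.single 0 1

theorem mulVec_ketZero_ne_zero {n : ℕ} (U : Op n) :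
    (U : Matrix (Bits n) (Bits n) ℂ).mulVec (ketZero n) ≠ 0 := by
  intro h
  have h1 : ketZero n = 0 := by
    have := congrArg ((star U : Op n) : Matrix (Bits n) (Bits n) ℂ).mulVec h
    rw [Matrix.mulVec_mulVec, Matrix.mulVec_zero] at this
    rwa [show ((star U : Op n) : Matrix (Bits n) (Bits n) ℂ) * (U : Matrix (Bits n) (Bits n) ℂ)
      = 1 from Matrix.UnitaryGroup.star_mul_self U, Matrix.one_mulVec] at this
  have h2 := congrFun h1 0
  simp [ketZero] at h2

/-- The state `U|0ⁿ⟩`. -/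
noncomputable def prepared {n : ℕ} (U : Op n) : PureState n :=
  Projectivization.mk ℂ ((U : Matrix (Bits n) (Bits n) ℂ).mulVec (ketZero n))
    (mulVec_ketZero_ne_zero U)

/-- The states that can be reached from `|0ⁿ⟩` by an operator in the Clifford group. -/
def stabilizerStates (n : ℕ) : Set (PureState n) := prepared '' (cliffordGroup n : Set (Op n))

/-! ### Generator matrices in reduced row echelon form -/

/-- `M` is a generator matrix of `V` in reduced row echelon form, with linearly independent rows
(so without zero rows), and `pivot r` is the column of the leading `1` of row `r`. -/
structure IsRREF {n k : ℕ} (V : Submodule (ZMod 2) (Bits n)) (M : Matrix (Fin k) (Fin n) (ZMod 2))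
    (pivot : Fin k → Fin n) : Prop where
  span_rows : Submodule.span (ZMod 2) (Set.range fun r => M r) = V
  strictMono_pivot : StrictMono pivot
  pivot_eq_one : ∀ r, M r (pivot r) = 1
  left_of_pivot : ∀ r j, j < pivot r → M r j = 0
  pivot_column : ∀ r s, s ≠ r → M s (pivot r) = 0

/-- The positions of the leading `1`s of the nonzero vectors of `V`. -/
def leadSet {n : ℕ} (V : Submodule (ZMod 2) (Bits n)) : Set (Fin n) :=
  {p | ∃ v ∈ V, v p = 1 ∧ ∀ j < p, v j = 0}

theorem zmod_two_cases (a : ZMod 2) : a = 0 ∨ a = 1 := by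
  revert a; decide

theorem exists_prescribed {n : ℕ} (V : Submodule (ZMod 2) (Bits n)) (m : ℕ) :
    ∀ f : Fin n → ZMod 2, (∀ j : Fin n, (j : ℕ) + m < n → f j = 0) →
      ∃ v ∈ V, (∀ p ∈ leadSet V, v p = f p) ∧ ∀ j : Fin n, (j : ℕ) + m < n → v j = 0 := by
  induction m with
  | zero =>
    intro f hf
    exact ⟨0, V.zero_mem, fun p _ => by simp [hf p (by simp)], fun _ _ => rfl⟩
  | succ m ih =>
    intro f hf
    by_cases hm : ∃ p ∈ leadSet V, (p : ℕ) + m + 1 = n ∧ f p = 1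
    · obtain ⟨p, ⟨w, hw, hwp, hwl⟩, hpn, hfp⟩ := hm
      obtain ⟨v, hv, hvp, hvl⟩ := ih (fun j => f j - w j) (by
        intro j hj
        rcases lt_trichotomy j p with h | h | h
        · have : (j : ℕ) < p := h
          simp [hf j (by omega), hwl j h]
        · subst h; simp [hfp, hwp]
        · have : (p : ℕ) < j := h
          omega)
      refine ⟨v + w, V.add_mem hv hw, fun q hq => by simp [hvp q hq], fun j hj => ?_⟩
      have : j < p := by
        change (j : ℕ) < p
        omega
      simp [hvl j (by omega), hwl j this]
    · obtain ⟨v, hv, hvp, hvl⟩ := ih (fun j => if (j : ℕ) + m < n then 0 else f j) (by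
        intro j hj
        simp [hj])
      refine ⟨v, hv, fun q hq => ?_, fun j hj => hvl j (by omega)⟩
      rw [hvp q hq]
      by_cases hqn : (q : ℕ) + m < n
      · simp only [hqn, if_true]
        rcases zmod_two_cases (f q) with h | h
        · exact h.symm
        · by_cases h' : (q : ℕ) + m + 1 = n
          · exact absurd ⟨q, hq, h', h⟩ hm
          · rw [hf q (by omega)]
      · simp [hqn]

theorem eq_zero_of_leadSet {n : ℕ} {V : Submodule (ZMod 2) (Bits n)} {v : Bits n} (hv : v ∈ V)
    (h : ∀ p ∈ leadSet V, v p = 0) : v = 0 := by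
  funext j
  induction j using WellFoundedLT.induction with
  | ind j ih =>
    rcases zmod_two_cases (v j) with h0 | h1
    · exact h0
    · exact h j ⟨v, hv, h1, ih⟩

open Classical in
theorem exists_isRREF {n : ℕ} (V : Submodule (ZMod 2) (Bits n)) :
    ∃ (M : Matrix (Fin (Module.finrank (ZMod 2) V)) (Fin n) (ZMod 2))
      (pivot : Fin (Module.finrank (ZMod 2) V) → Fin n), IsRREF V M pivot := by
  set P : Finset (Fin n) := Finset.univ.filter (· ∈ leadSet V) with hP
  have hPm : ∀ p, p ∈ P ↔ p ∈ leadSet V := fun p => by simp [hP]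
  let e := P.orderEmbOfFin rfl
  have hmem : ∀ r, e r ∈ leadSet V := fun r => (hPm _).1 (P.orderEmbOfFin_mem rfl r)
  have hsurj : ∀ p ∈ leadSet V, ∃ r, e r = p := fun p hp => by
    have : p ∈ Set.range e := by
      rw [P.range_orderEmbOfFin rfl]; exact (hPm p).2 hp
    exact this
  have hrow : ∀ r, ∃ v ∈ V, (∀ p ∈ leadSet V, v p = if p = e r then 1 else 0) ∧
      ∀ j < e r, v j = 0 := fun r => by
    obtain ⟨v, hv, h1, h2⟩ := exists_prescribed V (n - e r) (fun p => if p = e r then 1 else 0) (by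
      intro j hj
      rw [if_neg]
      rintro rfl
      omega)
    refine ⟨v, hv, h1, fun j hj => h2 j ?_⟩
    have : (j : ℕ) < e r := hj
    omega
  choose M hMV hM1 hM2 using hrow
  have hli : LinearIndependent (ZMod 2) M := by
    rw [Fintype.linearIndependent_iff]
    intro g hg r
    have := congrFun hg (e r)
    simp only [Finset.sum_apply, Pi.smul_apply, smul_eq_mul, Pi.zero_apply] at this
    rw [Finset.sum_eq_single r] at this
    · rw [hM1 r _ (hmem r)] at this; simpa using this
    · intro s _ hs
      rw [hM1 s _ (hmem r), if_neg, mul_zero]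
      exact fun h => hs (e.injective h).symm
    · simp
  have hspan : Submodule.span (ZMod 2) (Set.range M) = V := by
    apply le_antisymm
    · rw [Submodule.span_le]
      rintro _ ⟨r, rfl⟩
      exact hMV r
    · intro v hv
      have hs : ∑ r, v (e r) • M r ∈ Submodule.span (ZMod 2) (Set.range M) :=
        Submodule.sum_mem _ fun r _ => Submodule.smul_mem _ _ (Submodule.subset_span ⟨r, rfl⟩)
      have hsV : ∑ r, v (e r) • M r ∈ V :=
        Submodule.sum_mem _ fun r _ => Submodule.smul_mem _ _ (hMV r)
      have h0 : v - ∑ r, v (e r) • M r = 0 := by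
        refine eq_zero_of_leadSet (V.sub_mem hv hsV) fun p hp => ?_
        obtain ⟨r, rfl⟩ := hsurj p hp
        simp only [Pi.sub_apply, Finset.sum_apply, Pi.smul_apply, smul_eq_mul]
        rw [Finset.sum_eq_single r]
        · rw [hM1 r _ (hmem r)]; simp
        · intro s _ hs
          rw [hM1 s _ (hmem r), if_neg, mul_zero]
          exact fun h => hs (e.injective h).symm
        · simp
      rw [sub_eq_zero.1 h0]
      exact hs
  have hcard : Module.finrank (ZMod 2) V = P.card := by
    rw [← hspan, finrank_span_eq_card hli, Fintype.card_fin]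
  rw [hcard]
  refine ⟨M, e, hspan, e.strictMono, fun r => ?_, fun r j hj => hM2 r j hj, fun r s hs => ?_⟩
  · rw [hM1 r _ (hmem r), if_pos rfl]
  · rw [hM1 s _ (hmem r), if_neg]
    exact fun h => hs (e.injective h).symm

/-- The generator matrix of `V` in reduced row echelon form. -/
noncomputable def rref {n : ℕ} (V : Submodule (ZMod 2) (Bits n)) :
    Matrix (Fin (Module.finrank (ZMod 2) V)) (Fin n) (ZMod 2) :=
  (exists_isRREF V).choose

/-- The column of the leading `1` in each row of `rref V`. -/
noncomputable def pivot {n : ℕ} (V : Submodule (ZMod 2) (Bits n)) :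
    Fin (Module.finrank (ZMod 2) V) → Fin n :=
  (exists_isRREF V).choose_spec.choose

theorem isRREF_rref {n : ℕ} (V : Submodule (ZMod 2) (Bits n)) : IsRREF V (rref V) (pivot V) :=
  (exists_isRREF V).choose_spec.choose_spec

/-- The set of pivot columns of `rref V`. -/
noncomputable def pivotSet {n : ℕ} (V : Submodule (ZMod 2) (Bits n)) : Finset (Fin n) :=
  Finset.univ.image (pivot V)

/-! ### The sampling algorithm -/

/-- The weight `η(d) = 2^(-d(d+1)/2) ∏_{a=1}^d (1 - 2^(d-n-a)) / (1 - 2^(-a))`; `η(0) = 1`. -/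
noncomputable def eta (n d : ℕ) : ℝ :=
  (2 : ℝ) ^ (-((d * (d + 1) / 2 : ℕ) : ℤ)) *
    ∏ a ∈ Finset.Icc 1 d, (1 - (2 : ℝ) ^ ((d : ℤ) - n - a)) / (1 - (2 : ℝ) ^ (-(a : ℤ)))

theorem eta_pos {n d : ℕ} (h : d ≤ n) : 0 < eta n d := by
  refine mul_pos (by positivity) (Finset.prod_pos fun a ha => ?_)
  have ha1 := (Finset.mem_Icc.1 ha).1
  refine div_pos (sub_pos.2 ?_) (sub_pos.2 ?_)
  · exact zpow_lt_one_of_neg₀ (by norm_num) (by omega)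
  · exact zpow_lt_one_of_neg₀ (by norm_num) (by omega)

/-- The probability distribution `P(d) = η(d) / ∑_{m=0}^n η(m)` on `{0, …, n}`. -/
noncomputable def lawP (n : ℕ) : PMF (Fin (n + 1)) :=
  PMF.ofFintype (fun d => ENNReal.ofReal (eta n d / ∑ m ∈ Finset.range (n + 1), eta n m)) (by
    have hpos : 0 < ∑ m ∈ Finset.range (n + 1), eta n m :=
      Finset.sum_pos (fun m hm => eta_pos (by simpa [Nat.lt_succ_iff] using hm)) (by simp)
    rw [← ENNReal.ofReal_sum_of_nonneg, ← Finset.sum_div, ← Finset.sum_range (eta n ·),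
      div_self hpos.ne', ENNReal.ofReal_one]
    exact fun d _ => div_nonneg (eta_pos (Nat.lt_succ_iff.1 d.2)).le hpos.le)

/-- The finite set of the `k`-dimensional linear subspaces of `𝔽₂ⁿ`. -/
noncomputable def subspaces (n k : ℕ) : Finset (Submodule (ZMod 2) (Bits n)) :=
  (Set.toFinite {V : Submodule (ZMod 2) (Bits n) | Module.finrank (ZMod 2) V = k}).toFinset

theorem subspaces_nonempty {n k : ℕ} (h : k ≤ n) : (subspaces n k).Nonempty := by
  have hli : LinearIndependent (ZMod 2)
      fun r : Fin k => (Pi.single (Fin.castLE h r) 1 : Bits n) := by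
    have := (Pi.basisFun (ZMod 2) (Fin n)).linearIndependent.comp (Fin.castLE h)
      (Fin.castLE_injective h)
    convert this using 1
    funext r
    simp
  refine ⟨Submodule.span (ZMod 2)
    (Set.range fun r : Fin k => (Pi.single (Fin.castLE h r) 1 : Bits n)), ?_⟩
  rw [subspaces, Set.Finite.mem_toFinset, Set.mem_ofPred_eq, finrank_span_eq_card hli,
    Fintype.card_fin]

/-- The uniformly random subset of `A`: each element of `A` is included independently with
probability `1/2`. -/
noncomputable def randomSubset {α : Type} (A : Finset α) : PMF (Finset α) :=
  PMF.uniformOfFinset A.powerset ⟨∅, by simp⟩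

/-- The layer that applies `gate i` to every qubit `i ∈ A`. -/
noncomputable def layer {n : ℕ} (gate : Fin n → Op n) (A : Finset (Fin n)) : List (Op n) :=
  (List.finRange n).flatMap fun i => if i ∈ A then [gate i] else []

/-- For every row `r` of `rref V`, with pivot column `i`, and every column `j > i` with a `1` in
row `r`: the gate `CNOT` with control `i` and target `j`. -/
noncomputable def cnotLayer {n : ℕ} (V : Submodule (ZMod 2) (Bits n)) : List (Op n) :=
  (List.finRange (Module.finrank (ZMod 2) V)).flatMap fun r =>
    (List.finRange n).flatMap fun j =>
      if h : pivot V r < j ∧ rref V r j = 1 then [gateCNOT (pivot V r) j h.1.ne] else []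

/-- The layer that applies `CZ` to every pair of qubits in `C`. -/
noncomputable def czLayer {n : ℕ} (C : Finset (Fin n × Fin n)) : List (Op n) :=
  (List.finRange n).flatMap fun i => (List.finRange n).flatMap fun j =>
    if (i, j) ∈ C then [gateCZ i j] else []

/-- The unordered pairs of distinct elements of `T`, written with the smaller element first. -/
def pairs {n : ℕ} (T : Finset (Fin n)) : Finset (Fin n × Fin n) :=
  (T ×ˢ T).filter fun p => p.1 < p.2

/-- The unitary operator of a circuit, whose gates are listed in the order of application. -/
noncomputable def circuitOp {n : ℕ} (c : List (Op n)) : Op n := c.foldl (fun U g => g * U) 1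

/-- The law of the output of the algorithm: sample `d` from `lawP n` and then a uniformly random
linear subspace `V` of dimension `n - d`; with `T` the set of pivot columns of `rref V`, apply to
`|0ⁿ⟩` the gates `H` on `T`, the `CNOT` gates of `rref V`, `X` on a random subset of the complement
of `T`, `S` and then `Z` on random subsets of `T`, and `CZ` on a random set of pairs in `T`. -/
noncomputable def outputLaw (n : ℕ) : PMF (PureState n) :=
  (lawP n).bind fun d =>
  (PMF.uniformOfFinset (subspaces n (n - d)) (subspaces_nonempty (Nat.sub_le n d))).bind fun V =>
  (randomSubset (pivotSet V)ᶜ).bind fun A =>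
  (randomSubset (pivotSet V)).bind fun B =>
  (randomSubset (pivotSet V)).bind fun D =>
  (randomSubset (pairs (pivotSet V))).bind fun C =>
  PMF.pure (prepared (circuitOp
    (layer gateH (pivotSet V) ++ cnotLayer V ++ layer gateX A ++ layer gateS B ++ layer gateZ D ++
      czLayer C)))

end RandomStab

/-!
# The sampling algorithm outputs a uniformly random stabilizer state

A state is a stabilizer state if and only if its vector is, up to a scalar, of the form
`∑_{x ∈ a + V} i^{q(x)} |x⟩`, where `V` is a linear subspace of `𝔽₂ⁿ` and `q` is a quadratic
function with values in `ℤ/4` (`IsStabVec`, `IsQuadratic`).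

* Vectors of this form are preserved by the generators of the Clifford group
  (`IsStabVec.act_clifford`). Only the Hadamard gate on a qubit `i` needs an argument. If `eᵢ ∉ V`,
  the two terms of the gate have disjoint supports and the support doubles. If `eᵢ ∈ V`, they have
  the same support, and their ratio is `i^{c + 2ℓ(x)}` for a constant `c` and a linear form `ℓ`.
  For odd `c` the factor `1 + i^{c + 2ℓ(x)}` is a scalar times a power of `i` with quadratic
  exponent; for even `c` it is twice the indicator function of an affine hyperplane or of the
  whole space (it cannot vanish identically, since the gate is invertible).
* The circuit of the algorithm prepares exactly such a vector (`exists_act_circuit`): `H` and `CNOT`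
  create the uniform superposition of `V`, the `X` gates translate it by a vector `a` that vanishes
  on the pivot columns `T`, and `S`, `Z` and `CZ` contribute a quadratic polynomial in the bits at
  `T`. The bits at `T` are coordinates on `V`. Therefore every coset of `V` has exactly one
  representative that vanishes on `T`, and every quadratic function on `a + V` is, up to a
  constant, exactly one such polynomial. So every stabilizer state is prepared for exactly one value
  of the random choices (`IsStabVec.exists_circuit`, `circuit_injective`).
* A state with `dim V = k = n - d` is thus output with probability
  `P(d) / ([n choose k]₂ · 2^{d + 2k + k(k-1)/2})`. The number `[n choose k]₂` of subspaces is
  counted by means of ordered bases (`card_subspaces_mul`) and equals `η(d) 2^{d(d+1)/2 + dk}`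
  (`eta_mul`), so the probability depends only on `n` (`toReal_outputLaw`). A law that is constant
  on a finite set and vanishes outside it is uniform (`eq_uniformOfFinset`); the number of
  stabilizer states is not needed.
-/

namespace RandomStab

/-! ### Quadratic functions with values in `ℤ/4` -/

/-- The fourth root of unity `i ^ a`. -/
noncomputable def phase (a : ZMod 4) : ℂ := Complex.I ^ a.val

/-- The set-theoretic lift of a bit to `{0, 1} ⊆ ℤ/4`. It is not additive. -/
def lift (a : ZMod 2) : ZMod 4 := (a.val : ZMod 4)

theorem phase_add (a b : ZMod 4) : phase (a + b) = phase a * phase b := by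
  rw [phase, phase, phase, ZMod.val_add, ← Complex.I_pow_eq_pow_mod, pow_add]

@[simp] theorem phase_zero : phase 0 = 1 := by simp [phase]

theorem phase_ne_zero (a : ZMod 4) : phase a ≠ 0 := pow_ne_zero _ Complex.I_ne_zero

theorem phase_neg_mul_self (a : ZMod 4) : phase (-a) * phase a = 1 := by
  rw [← phase_add, neg_add_cancel, phase_zero]

theorem phase_one : phase 1 = Complex.I := by
  have : (1 : ZMod 4).val = 1 := rfl
  rw [phase, this, pow_one]

theorem phase_two : phase 2 = -1 := by
  have : (2 : ZMod 4).val = 2 := rfl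
  rw [phase, this, Complex.I_sq]

theorem phase_three : phase 3 = -Complex.I := by
  have : (3 : ZMod 4).val = 3 := rfl
  rw [phase, this, Complex.I_pow_three]

theorem zmod_four_cases (a : ZMod 4) : a = 0 ∨ a = 1 ∨ a = 2 ∨ a = 3 := by
  revert a; decide

theorem phase_injective : Function.Injective phase := by
  intro a b h
  have key : ∀ a : ZMod 4, phase a = 1 → a = 0 := by
    intro a ha
    rcases zmod_four_cases a with rfl | rfl | rfl | rfl
    · rfl
    · rw [phase_one] at ha; simp [Complex.ext_iff] at ha
    · rw [phase_two] at ha; norm_num [Complex.ext_iff] at ha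
    · rw [phase_three] at ha; simp [Complex.ext_iff] at ha
  have h2 : phase (-b + a) = 1 := by rw [phase_add, h, phase_neg_mul_self]
  have := key _ h2
  rwa [neg_add_eq_zero, eq_comm] at this

@[simp] theorem lift_zero : lift 0 = 0 := rfl
@[simp] theorem lift_one : lift 1 = 1 := rfl

theorem lift_add (a b : ZMod 2) : lift (a + b) = lift a + lift b + 2 * lift (a * b) := by
  revert a b; decide

theorem lift_add_one (a : ZMod 2) : lift (a + 1) = 1 - lift a := by
  revert a; decide

theorem two_mul_lift_add (a b : ZMod 2) : 2 * lift (a + b) = 2 * lift a + 2 * lift b := by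
  revert a b; decide

theorem lift_mul (a b : ZMod 2) : lift (a * b) = lift a * lift b := by
  revert a b; decide

theorem neg_two_mul_lift (a : ZMod 2) : -(2 * lift a) = 2 * lift a := by
  revert a; decide

section Quadratic

variable {E F : Type*} [AddCommGroup E] [Module (ZMod 2) E] [AddCommGroup F] [Module (ZMod 2) F]

/-- A `ℤ/4`-valued quadratic function on an `𝔽₂`-vector space: its deviation from additivity is
twice a bilinear form over `𝔽₂`. Constants are included, so `q 0` is arbitrary. -/
def IsQuadratic (q : E → ZMod 4) : Prop :=
  ∃ B : E →ₗ[ZMod 2] E →ₗ[ZMod 2] ZMod 2,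
    ∀ x y, q (x + y) + q 0 = q x + q y + 2 * lift (B x y)

theorem isQuadratic_const (c : ZMod 4) : IsQuadratic fun _ : E => c :=
  ⟨0, fun x y => by simp⟩

theorem IsQuadratic.add {p q : E → ZMod 4} (hp : IsQuadratic p) (hq : IsQuadratic q) :
    IsQuadratic fun x => p x + q x := by
  obtain ⟨B, hB⟩ := hp
  obtain ⟨C, hC⟩ := hq
  refine ⟨B + C, fun x y => ?_⟩
  simp only [LinearMap.add_apply, two_mul_lift_add]
  linear_combination hB x y + hC x y

theorem IsQuadratic.neg {q : E → ZMod 4} (hq : IsQuadratic q) :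
    IsQuadratic fun x => -q x := by
  obtain ⟨B, hB⟩ := hq
  refine ⟨B, fun x y => ?_⟩
  rw [← neg_two_mul_lift]
  linear_combination -hB x y

theorem IsQuadratic.sub {p q : E → ZMod 4} (hp : IsQuadratic p) (hq : IsQuadratic q) :
    IsQuadratic fun x => p x - q x := by
  simpa only [sub_eq_add_neg] using hp.add hq.neg

theorem IsQuadratic.const_mul {q : E → ZMod 4} (hq : IsQuadratic q) (c : ZMod 4) :
    IsQuadratic fun x => c * q x := by
  rcases zmod_four_cases c with rfl | rfl | rfl | rfl
  · simpa using isQuadratic_const (E := E) 0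
  · simpa using hq
  · simpa only [two_mul] using hq.add hq
  · have h3 : (3 : ZMod 4) = -1 := by decide
    simpa only [h3, neg_mul, one_mul] using hq.neg

theorem isQuadratic_lift (l : E →ₗ[ZMod 2] ZMod 2) (b : ZMod 2) :
    IsQuadratic fun x => lift (l x + b) := by
  -- The carry of the addition of two bits is their product.
  have h : IsQuadratic fun x => lift (l x) :=
    ⟨(LinearMap.mul (ZMod 2) (ZMod 2)).compl₁₂ l l, fun x y => by simp [lift_add]⟩
  rcases zmod_two_cases b with rfl | rfl
  · simpa using h
  · simpa only [lift_add_one] using (isQuadratic_const 1).sub h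

theorem isQuadratic_two_mul_lift_mul (l m : E →ₗ[ZMod 2] ZMod 2) (b c : ZMod 2) :
    IsQuadratic fun x => 2 * lift ((l x + b) * (m x + c)) := by
  -- Polarization: `2 (ab)` is the difference between `lift (a + b)` and `lift a + lift b`.
  have h := (isQuadratic_lift (l + m) (b + c)).sub
    ((isQuadratic_lift l b).add (isQuadratic_lift m c))
  convert h using 2 with x
  have := lift_add (l x + b) (m x + c)
  rw [LinearMap.add_apply, add_add_add_comm]
  linear_combination -this

theorem IsQuadratic.comp_affine {q : E → ZMod 4} (hq : IsQuadratic q) (g : F →ₗ[ZMod 2] E) (b : E) :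
    IsQuadratic fun x => q (g x + b) := by
  obtain ⟨B, hB⟩ := hq
  refine ⟨B.compl₁₂ g g, fun x y => ?_⟩
  have h1 := hB (g x + b) (g y)
  have h2 := hB b (g y)
  rw [add_right_comm] at h1
  rw [add_comm b] at h2
  simp only [map_add, map_zero, zero_add, LinearMap.add_apply, two_mul_lift_add,
    LinearMap.compl₁₂_apply] at *
  linear_combination h1 - h2

/-- The increment of a quadratic function in a fixed direction. -/
theorem IsQuadratic.exists_increment {q : E → ZMod 4} (hq : IsQuadratic q) (e : E) :
    ∃ (c : ZMod 4) (l : E →ₗ[ZMod 2] ZMod 2), ∀ x, q (x + e) = q x + (c + 2 * lift (l x)) := by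
  obtain ⟨B, hB⟩ := hq
  refine ⟨q e - q 0, B.flip e, fun x => ?_⟩
  rw [LinearMap.flip_apply]
  linear_combination hB x e

/-- The ordered pairs in a set with a new largest element: the pairs of old elements and the pairs
that end in the new one. -/
theorem filter_lt_insert_max {n : ℕ} {a : Fin n} {s : Finset (Fin n)} (ha : ∀ x ∈ s, x < a) :
    ((insert a s) ×ˢ (insert a s)).filter (fun p : Fin n × Fin n => p.1 < p.2) =
      (s ×ˢ s).filter (fun p => p.1 < p.2) ∪ s.image (fun i => (i, a)) ∧
    Disjoint ((s ×ˢ s).filter (fun p : Fin n × Fin n => p.1 < p.2)) (s.image fun i => (i, a)) := by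
  constructor
  · ext ⟨i, j⟩
    simp only [Finset.mem_filter, Finset.mem_product, Finset.mem_insert, Finset.mem_union,
      Finset.mem_image, Prod.mk.injEq]
    constructor
    · rintro ⟨⟨rfl | hi, rfl | hj⟩, hlt⟩
      · exact absurd hlt (lt_irrefl _)
      · exact absurd hlt (ha j hj).not_gt
      · exact Or.inr ⟨i, hi, rfl, rfl⟩
      · exact Or.inl ⟨⟨hi, hj⟩, hlt⟩
    · rintro (⟨⟨hi, hj⟩, hlt⟩ | ⟨k, hk, rfl, rfl⟩)
      · exact ⟨⟨Or.inr hi, Or.inr hj⟩, hlt⟩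
      · exact ⟨⟨Or.inr hk, Or.inl rfl⟩, ha k hk⟩
  · rw [Finset.disjoint_left]
    rintro ⟨i, j⟩ h1 h2
    simp only [Finset.mem_filter, Finset.mem_product, Finset.mem_image, Prod.mk.injEq] at h1 h2
    obtain ⟨k, _, _, rfl⟩ := h2
    exact lt_irrefl _ (ha _ h1.1.2)

/-- The polynomial form of a quadratic function along a family of vectors. -/
theorem IsQuadratic.exists_expansion {n : ℕ} {q : E → ZMod 4} (hq : IsQuadratic q) (u : Fin n → E) :
    ∃ (b : Fin n → ZMod 4) (C : Fin n → Fin n → ZMod 2),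
      ∀ (s : Finset (Fin n)) (y : Fin n → ZMod 2),
      q (∑ i ∈ s, y i • u i) = q 0 + ∑ i ∈ s, b i * lift (y i) +
        ∑ p ∈ (s ×ˢ s).filter (fun p => p.1 < p.2), 2 * lift (C p.1 p.2 * (y p.1 * y p.2)) := by
  obtain ⟨B, hB⟩ := hq
  refine ⟨fun i => q (u i) - q 0, fun i j => B (u j) (u i), fun s y => ?_⟩
  induction s using Finset.induction_on_max with
  | empty => simp
  | insert a s ha ih =>
    have has : a ∉ s := fun h => lt_irrefl _ (ha a h)
    obtain ⟨hfil, hdis⟩ := filter_lt_insert_max ha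
    have hsum : ∀ t : Finset (Fin n), 2 * lift (B (y a • u a) (∑ i ∈ t, y i • u i)) =
        ∑ i ∈ t, 2 * lift (B (u a) (u i) * (y i * y a)) := by
      intro t
      induction t using Finset.induction_on with
      | empty => simp
      | insert j t hj iht =>
        rw [Finset.sum_insert hj, Finset.sum_insert hj, map_add, two_mul_lift_add, iht]
        congr 3
        simp only [map_smul, LinearMap.smul_apply, smul_eq_mul]
        ring
    have hone : q (y a • u a) = q 0 + (q (u a) - q 0) * lift (y a) := by
      rcases zmod_two_cases (y a) with h | h <;> simp [h]
    rw [hfil, Finset.sum_union hdis, Finset.sum_image (fun i _ j _ h => (Prod.mk.inj h).1),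
      Finset.sum_insert has, Finset.sum_insert has]
    dsimp only
    rw [← hsum s]
    linear_combination hB (y a • u a) (∑ i ∈ s, y i • u i) + ih + hone

end Quadratic

variable {n : ℕ}

/-! ### The gates acting on state vectors -/

/-- The action of an operator on a state vector. -/
noncomputable def act (U : Op n) (f : Bits n → ℂ) : Bits n → ℂ :=
  (U : Matrix (Bits n) (Bits n) ℂ).mulVec f

theorem act_one (f : Bits n → ℂ) : act 1 f = f := by simp [act]

theorem act_mul (U W : Op n) (f : Bits n → ℂ) : act (U * W) f = act U (act W f) := by
  simp [act, Matrix.mulVec_mulVec]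

theorem act_ne_zero (U : Op n) {f : Bits n → ℂ} (hf : f ≠ 0) : act U f ≠ 0 := by
  intro h
  have h1 : act (U⁻¹ * U) f = 0 := by rw [act_mul, h]; simp [act]
  rw [inv_mul_cancel, act_one] at h1
  exact hf h1

theorem inv_sqrt_two_mul_self :
    ((Real.sqrt 2 : ℝ) : ℂ)⁻¹ * ((Real.sqrt 2 : ℝ) : ℂ)⁻¹ = 1 / 2 := by
  rw [← mul_inv, ← Complex.ofReal_mul, Real.mul_self_sqrt (by norm_num)]
  norm_num

theorem inv_sqrt_two_ne_zero : ((Real.sqrt 2 : ℝ) : ℂ)⁻¹ ≠ 0 := by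
  rw [ne_eq, inv_eq_zero, Complex.ofReal_eq_zero]
  positivity

theorem sum_zmod_two {M : Type*} [AddCommMonoid M] (g : ZMod 2 → M) : ∑ b, g b = g 0 + g 1 :=
  Fin.sum_univ_two g

theorem matX_apply : matX 0 0 = 0 ∧ matX 0 1 = 1 ∧ matX 1 0 = 1 ∧
    matX 1 1 = 0 :=
  ⟨rfl, rfl, rfl, rfl⟩

theorem matZ_apply : matZ 0 0 = 1 ∧ matZ 0 1 = 0 ∧ matZ 1 0 = 0 ∧
    matZ 1 1 = -1 :=
  ⟨rfl, rfl, rfl, rfl⟩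

theorem matS_apply : matS 0 0 = 1 ∧ matS 0 1 = 0 ∧ matS 1 0 = 0 ∧
    matS 1 1 = Complex.I :=
  ⟨rfl, rfl, rfl, rfl⟩

theorem matH_apply : matH 0 0 = 1 / ((Real.sqrt 2 : ℝ) : ℂ) ∧
    matH 0 1 = 1 / ((Real.sqrt 2 : ℝ) : ℂ) ∧ matH 1 0 = 1 / ((Real.sqrt 2 : ℝ) : ℂ) ∧
    matH 1 1 = -1 / ((Real.sqrt 2 : ℝ) : ℂ) :=
  ⟨rfl, rfl, rfl, rfl⟩

theorem onQubit_mulVec (i : Fin n) (A : Matrix (ZMod 2) (ZMod 2) ℂ) (f : Bits n → ℂ) (x : Bits n) :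
    (onQubit i A).mulVec f x = ∑ b, A (x i) b * f (Function.update x i b) := by
  rw [Matrix.mulVec, dotProduct]
  symm
  refine Finset.sum_of_injOn (fun b => Function.update x i b) ?_ ?_ ?_ ?_
  · intro b _ c _ hbc
    simpa using congrFun hbc i
  · intro b _
    simp
  · intro z _ hz
    rw [onQubit, Matrix.of_apply, if_neg, zero_mul]
    intro hxz
    refine hz ⟨z i, by simp, ?_⟩
    funext j
    by_cases hj : j = i
    · subst hj; simp
    · simp [hj, hxz j hj]
  · intro b _
    rw [onQubit, Matrix.of_apply, if_pos (fun j hj => by simp [hj])]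
    simp

theorem update_self_add (x : Bits n) (i : Fin n) (b : ZMod 2) :
    Function.update x i (x i + b) = x + b • Pi.single i 1 := by
  funext j
  by_cases hj : j = i
  · subst hj; simp
  · simp [hj]

theorem act_gateX (i : Fin n) (f : Bits n → ℂ) (x : Bits n) :
    act (gateX i) f x = f (x + Pi.single i 1) := by
  have h := update_self_add x i 1
  rw [one_smul] at h
  rw [act, gateX, onQubit_mulVec, ← h, sum_zmod_two]
  rcases zmod_two_cases (x i) with hx | hx <;> rw [hx]
  · simp [matX_apply]
  · have : (1 + 1 : ZMod 2) = 0 := rfl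
    simp [matX_apply, this]

theorem act_gateZ (i : Fin n) (f : Bits n → ℂ) (x : Bits n) :
    act (gateZ i) f x = phase (2 * lift (x i)) * f x := by
  rw [act, gateZ, onQubit_mulVec, sum_zmod_two]
  conv_rhs => rw [← Function.update_eq_self i x]
  rcases zmod_two_cases (x i) with hx | hx <;> simp [hx, matZ_apply, phase_two]

theorem act_gateS (i : Fin n) (f : Bits n → ℂ) (x : Bits n) :
    act (gateS i) f x = phase (lift (x i)) * f x := by
  rw [act, gateS, onQubit_mulVec, sum_zmod_two]
  conv_rhs => rw [← Function.update_eq_self i x]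
  rcases zmod_two_cases (x i) with hx | hx <;> simp [hx, matS_apply, phase_one]

theorem act_gateH (i : Fin n) (f : Bits n → ℂ) (x : Bits n) :
    act (gateH i) f x = ((Real.sqrt 2 : ℝ) : ℂ)⁻¹ *
      (f (Function.update x i 0) + phase (2 * lift (x i)) * f (Function.update x i 1)) := by
  rw [act, gateH, onQubit_mulVec, sum_zmod_two]
  rcases zmod_two_cases (x i) with hx | hx <;> simp [hx, matH_apply, phase_two] <;> ring

/-- The Hadamard gate in terms of the bit flip, without reference to the value of the bit. -/
theorem act_gateH' (i : Fin n) (f : Bits n → ℂ) (x : Bits n) :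
    act (gateH i) f x = ((Real.sqrt 2 : ℝ) : ℂ)⁻¹ *
      (phase (2 * lift (x i)) * f x + f (x + Pi.single i 1)) := by
  have h := update_self_add x i 1
  rw [one_smul] at h
  have h0 := Function.update_eq_self i x
  rw [act_gateH, ← h]
  conv_rhs => enter [2, 1, 2, 1]; rw [← h0]
  rcases zmod_two_cases (x i) with hx | hx <;> rw [hx]
  · simp
  · have : (1 + 1 : ZMod 2) = 0 := rfl
    rw [this, add_comm]

theorem matCNOT_apply (i j : Fin n) (x y : Bits n) :
    matCNOT i j x y = if x = Function.update y j (y j + y i) then 1 else 0 := rfl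

theorem act_gateCNOT (i j : Fin n) (h : i ≠ j) (f : Bits n → ℂ) (x : Bits n) :
    act (gateCNOT i j h) f x = f (x + x i • Pi.single j 1) := by
  change ∑ y, matCNOT i j x y * f y = _
  rw [Finset.sum_eq_single (x + x i • Pi.single j 1),
    ← update_self_add]
  · rw [matCNOT_apply, if_pos (cnot_invol h x).symm, one_mul]
  · intro y _ hy
    rw [matCNOT_apply, if_neg, zero_mul]
    rintro rfl
    apply hy
    rw [← update_self_add, cnot_invol h]
  · simp

theorem act_gateCZ (i j : Fin n) (f : Bits n → ℂ) (x : Bits n) :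
    act (gateCZ i j) f x = phase (2 * lift (x i * x j)) * f x := by
  change (matCZ i j).mulVec f x = _
  rw [matCZ, Matrix.mulVec_diagonal]
  rcases zmod_two_cases (x i) with hx | hx <;> rcases zmod_two_cases (x j) with hy | hy <;>
    simp [hx, hy, phase_two]

/-- Operators are determined by their action on state vectors. -/
theorem act_injective {U W : Op n} (h : ∀ f x, act U f x = act W f x) : U = W := by
  refine Subtype.ext (Matrix.ext_of_mulVec_single fun i => ?_)
  exact funext fun x => h _ x

theorem gateZ_eq (i : Fin n) : gateZ i = gateS i * gateS i :=
  act_injective fun f x => by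
    rw [act_mul, act_gateZ, act_gateS, act_gateS, ← mul_assoc, ← phase_add, two_mul]

theorem gateX_eq (i : Fin n) : gateX i = gateH i * gateZ i * gateH i :=
  act_injective fun f x => by
    have h2 := inv_sqrt_two_mul_self
    rw [act_mul, act_mul, act_gateX, act_gateH', act_gateZ, act_gateZ, act_gateH', act_gateH']
    have hx : x + Pi.single i 1 + Pi.single i 1 = x := by
      rw [add_assoc, ZModModule.add_self, add_zero]
    rw [hx]
    rcases zmod_two_cases (x i) with h | h
    · simp only [h, lift_zero, Pi.add_apply, Pi.single_eq_same, zero_add, lift_one, mul_zero,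
        mul_one, phase_two, phase_zero]
      linear_combination -2 * f (x + Pi.single i 1) * h2
    · have : (1 + 1 : ZMod 2) = 0 := rfl
      simp only [h, lift_zero, Pi.add_apply, Pi.single_eq_same, this, lift_one, mul_zero,
        mul_one, phase_two, phase_zero]
      linear_combination -2 * f (x + Pi.single i 1) * h2

theorem gateH_mul_self (i : Fin n) : gateH i * gateH i = 1 :=
  act_injective fun f x => by
    have h2 := inv_sqrt_two_mul_self
    rw [act_mul, act_one, act_gateH', act_gateH', act_gateH']
    have hx : x + Pi.single i 1 + Pi.single i 1 = x := by
      rw [add_assoc, ZModModule.add_self, add_zero]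
    rw [hx]
    rcases zmod_two_cases (x i) with h | h
    · simp only [h, lift_zero, Pi.add_apply, Pi.single_eq_same, zero_add, lift_one, mul_zero,
        mul_one, phase_two, phase_zero]
      linear_combination 2 * f x * h2
    · have : (1 + 1 : ZMod 2) = 0 := rfl
      simp only [h, lift_zero, Pi.add_apply, Pi.single_eq_same, this, lift_one, mul_zero,
        mul_one, phase_two, phase_zero]
      linear_combination 2 * f x * h2

theorem gateCZ_eq {i j : Fin n} (h : i ≠ j) :
    gateCZ i j = gateH j * gateCNOT i j h * gateH j :=
  act_injective fun f x => by
    have h2 := inv_sqrt_two_mul_self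
    have hx : x + Pi.single j 1 + Pi.single j 1 = x := by
      rw [add_assoc, ZModModule.add_self, add_zero]
    have hij : (x + Pi.single j 1 : Bits n) i = x i := by simp [h]
    have e : (1 + 1 : ZMod 2) = 0 := rfl
    rw [act_mul, act_mul, act_gateCZ, act_gateH', act_gateCNOT, act_gateCNOT, act_gateH',
      act_gateH', hij]
    rcases zmod_two_cases (x i) with hi | hi <;> rcases zmod_two_cases (x j) with hj | hj <;>
      simp only [hi, hj, zero_smul, one_smul, add_zero, hx, Pi.zero_apply, Pi.add_apply,
        Pi.single_eq_same, e,
        lift_zero, lift_one, mul_zero, mul_one, zero_add, phase_zero, phase_two] <;>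
      first
        | linear_combination -2 * f x * h2
        | linear_combination 2 * f x * h2

theorem gateCNOT_mul_self (i j : Fin n) (h : i ≠ j) : gateCNOT i j h * gateCNOT i j h = 1 :=
  act_injective fun f x => by
    have hij : (x + x i • Pi.single j 1 : Bits n) i = x i := by simp [h]
    rw [act_mul, act_one, act_gateCNOT, act_gateCNOT, hij, add_assoc, ZModModule.add_self, add_zero]

theorem gateS_pow_four (i : Fin n) : gateS i * (gateS i * (gateS i * gateS i)) = 1 :=
  act_injective fun f x => by
    simp only [act_mul, act_one, act_gateS, ← mul_assoc, ← phase_add]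
    have : ∀ a : ZMod 2, lift a + (lift a + (lift a + lift a)) = 0 := by decide
    rw [this, phase_zero, one_mul]

theorem gateH_mem (i : Fin n) : gateH i ∈ cliffordGroup n :=
  Subgroup.subset_closure (Or.inl (Or.inl ⟨i, rfl⟩))

theorem gateS_mem (i : Fin n) : gateS i ∈ cliffordGroup n :=
  Subgroup.subset_closure (Or.inl (Or.inr ⟨i, rfl⟩))

theorem gateCNOT_mem (i j : Fin n) (h : i ≠ j) : gateCNOT i j h ∈ cliffordGroup n :=
  Subgroup.subset_closure (Or.inr ⟨i, j, h, rfl⟩)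

theorem gateZ_mem (i : Fin n) : gateZ i ∈ cliffordGroup n := by
  rw [gateZ_eq]
  exact mul_mem (gateS_mem i) (gateS_mem i)

theorem gateX_mem (i : Fin n) : gateX i ∈ cliffordGroup n := by
  rw [gateX_eq]
  exact mul_mem (mul_mem (gateH_mem i) (gateZ_mem i)) (gateH_mem i)

theorem gateCZ_mem {i j : Fin n} (h : i ≠ j) : gateCZ i j ∈ cliffordGroup n := by
  rw [gateCZ_eq h]
  exact mul_mem (mul_mem (gateH_mem j) (gateCNOT_mem i j h)) (gateH_mem j)

/-! ### Affine support and quadratic phase -/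

/-- State vectors of constant modulus on an affine subspace of `𝔽₂ⁿ` and zero outside it, with a
`ℤ/4`-valued quadratic phase. The affine subspace is written as `{x | x + a ∈ V}`, which is `a + V`
in characteristic two. -/
def IsStabVec (f : Bits n → ℂ) : Prop :=
  ∃ (c : ℂ) (V : Submodule (ZMod 2) (Bits n)) (a : Bits n) (q : Bits n → ZMod 4),
    c ≠ 0 ∧ IsQuadratic q ∧
      ∀ x, (x + a ∈ V → f x = c * phase (q x)) ∧ (x + a ∉ V → f x = 0)

theorem IsStabVec.ne_zero {f : Bits n → ℂ} (hf : IsStabVec f) : f ≠ 0 := by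
  obtain ⟨c, V, a, q, hc, _, h⟩ := hf
  intro h0
  have := (h a).1 (by rw [ZModModule.add_self]; exact V.zero_mem)
  rw [h0] at this
  exact mul_ne_zero hc (phase_ne_zero _) this.symm

theorem isStabVec_ketZero : IsStabVec (ketZero n) := by
  refine ⟨1, ⊥, 0, fun _ => 0, one_ne_zero, isQuadratic_const 0,
    fun x => ⟨fun hx => ?_, fun hx => ?_⟩⟩
  · rw [add_zero, Submodule.mem_bot] at hx
    simp [ketZero, hx]
  · rw [add_zero, Submodule.mem_bot] at hx
    simp [ketZero, hx]

theorem IsStabVec.gateS {f : Bits n → ℂ} (hf : IsStabVec f) (i : Fin n) :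
    IsStabVec (act (gateS i) f) := by
  obtain ⟨c, V, a, q, hc, hq, h⟩ := hf
  refine ⟨c, V, a, fun x => lift (x i) + q x, hc, ?_, fun x => ⟨fun hx => ?_, fun hx => ?_⟩⟩
  · simpa using (isQuadratic_lift (LinearMap.proj i : Bits n →ₗ[ZMod 2] ZMod 2) 0).add hq
  · rw [act_gateS, (h x).1 hx, phase_add]
    ring
  · rw [act_gateS, (h x).2 hx, mul_zero]

theorem IsStabVec.gateCNOT {f : Bits n → ℂ} (hf : IsStabVec f) (i j : Fin n) (hij : i ≠ j) :
    IsStabVec (act (gateCNOT i j hij) f) := by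
  obtain ⟨c, V, a, q, hc, hq, h⟩ := hf
  let g : Bits n →ₗ[ZMod 2] Bits n :=
    LinearMap.id + (LinearMap.proj i : Bits n →ₗ[ZMod 2] ZMod 2).smulRight (Pi.single j 1)
  have hg : ∀ x, g x = x + x i • Pi.single j 1 := fun x => rfl
  have hgg : ∀ x, g (g x) = x := fun x => by
    have hx : (g x) i = x i := by rw [hg]; simp [hij]
    rw [hg (g x), hx, hg, add_assoc, ZModModule.add_self, add_zero]
  have hmem : ∀ x, x + g a ∈ V.comap g ↔ g x + a ∈ V := fun x => by
    rw [Submodule.mem_comap, map_add, hgg]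
  refine ⟨c, V.comap g, g a, fun x => q (g x), hc, ?_, fun x => ⟨fun hx => ?_, fun hx => ?_⟩⟩
  · simpa using hq.comp_affine g 0
  · rw [act_gateCNOT, ← hg, (h (g x)).1 ((hmem x).1 hx)]
  · rw [act_gateCNOT, ← hg, (h (g x)).2 (fun h' => hx ((hmem x).2 h'))]

/-- If the support is not invariant under the flip of the qubit, the Hadamard gate doubles it: only
one of the two terms of `act_gateH'` is nonzero. -/
theorem IsStabVec.gateH_of_notMem {f : Bits n → ℂ} {c : ℂ} {V : Submodule (ZMod 2) (Bits n)}
    {a : Bits n} {q : Bits n → ZMod 4} (hc : c ≠ 0) (hq : IsQuadratic q)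
    (h : ∀ x, (x + a ∈ V → f x = c * phase (q x)) ∧ (x + a ∉ V → f x = 0)) {i : Fin n}
    (hi : Pi.single i 1 ∉ V) : IsStabVec (act (RandomStab.gateH i) f) := by
  obtain ⟨l, hl, hV⟩ := Submodule.exists_le_ker_of_notMem hi
  set e : Bits n := Pi.single i 1 with he
  have hl1 : l e = 1 := (zmod_two_cases _).resolve_left hl
  have hV0 : ∀ v ∈ V, l v = 0 := fun v hv => hV hv
  let g : Bits n →ₗ[ZMod 2] Bits n := LinearMap.id + l.smulRight e
  have hg : ∀ x, g x = x + l x • e := fun x => rfl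
  have hr := inv_sqrt_two_ne_zero
  refine ⟨((Real.sqrt 2 : ℝ) : ℂ)⁻¹ * c, V.comap g, a,
    fun x => 2 * lift ((l x + (l a + 1)) * x i) + q (g x + l a • e),
    mul_ne_zero hr hc, ?_, fun x => ?_⟩
  · refine IsQuadratic.add ?_ (hq.comp_affine g _)
    simpa using isQuadratic_two_mul_lift_mul l (LinearMap.proj i : Bits n →ₗ[ZMod 2] ZMod 2)
      (l a + 1) 0
  · have hx : g x + l a • e = x + l (x + a) • e := by
      rw [hg, map_add, add_smul, add_assoc]
    rw [Submodule.mem_comap, hg, act_gateH', ← he]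
    beta_reduce
    rw [← add_assoc (l x), hx, ← map_add]
    have h11 : (1 + 1 : ZMod 2) = 0 := rfl
    rcases zmod_two_cases (l (x + a)) with h0 | h1
    · rw [h0, zero_smul, add_zero, add_zero, zero_add, one_mul]
      have hne : x + e + a ∉ V := fun hm => by
        have := hV0 _ hm
        rw [add_right_comm, map_add, h0, hl1] at this
        simp at this
      rw [(h (x + e)).2 hne]
      refine ⟨fun hx => ?_, fun hx => ?_⟩
      · rw [(h x).1 hx, phase_add]; ring
      · rw [(h x).2 hx]; ring
    · rw [h1, one_smul, h11, zero_mul, lift_zero, mul_zero, zero_add]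
      have hne : x + a ∉ V := fun hm => by
        have := hV0 _ hm
        rw [h1] at this
        simp at this
      rw [(h x).2 hne, add_right_comm]
      refine ⟨fun hx => ?_, fun hx => ?_⟩
      · rw [(h (x + e)).1 hx]; ring
      · rw [(h (x + e)).2 hx]; ring

/-- The two terms of a Hadamard gate add up to a multiple of a fourth root of unity if their
relative phase is imaginary. -/
theorem one_add_phase_odd {c : ZMod 4} (hc : c = 1 ∨ c = 3) (s : ZMod 2) :
    1 + phase (c + 2 * lift s) = (1 + phase c) * phase (-c * lift s) ∧ 1 + phase c ≠ 0 := by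
  have e1 : (1 + 2 : ZMod 4) = 3 := rfl
  have e2 : (3 + 2 : ZMod 4) = 1 := rfl
  have e3 : (-1 : ZMod 4) = 3 := rfl
  have e4 : (-3 : ZMod 4) = 1 := rfl
  rcases hc with rfl | rfl <;> refine ⟨?_, ?_⟩
  · rcases zmod_two_cases s with rfl | rfl
    · simp
    · simp only [lift_one, mul_one, e1, e3, phase_one, phase_three]
      linear_combination Complex.I_sq
  · rw [phase_one]; simp [Complex.ext_iff]
  · rcases zmod_two_cases s with rfl | rfl
    · simp
    · simp only [lift_one, mul_one, e2, e4, phase_one, phase_three]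
      linear_combination Complex.I_sq
  · rw [phase_three]; simp [Complex.ext_iff]

theorem one_add_phase_even (t s : ZMod 2) :
    (s = t → 1 + phase (2 * lift t + 2 * lift s) = 2) ∧
    (s ≠ t → 1 + phase (2 * lift t + 2 * lift s) = 0) := by
  rw [← two_mul_lift_add]
  have h11 : (1 + 1 : ZMod 2) = 0 := rfl
  refine ⟨?_, fun hst => ?_⟩
  · rintro rfl
    rw [ZModModule.add_self]; simp; norm_num
  · rcases zmod_two_cases t with rfl | rfl <;> rcases zmod_two_cases s with rfl | rfl <;>
      simp_all [phase_two]

theorem zmod_four_odd_or_even (c : ZMod 4) : (c = 1 ∨ c = 3) ∨ ∃ t : ZMod 2, c = 2 * lift t := by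
  revert c; decide

/-- If the support is invariant under the flip of the qubit, the two terms of `act_gateH'` have the
same support and interfere. Their relative phase is a constant times a sign given by an affine
function: either the sum has constant modulus, or the terms cancel on an affine hyperplane of the
support. -/
theorem IsStabVec.gateH_of_mem {f : Bits n → ℂ} {c : ℂ} {V : Submodule (ZMod 2) (Bits n)}
    {a : Bits n} {q : Bits n → ZMod 4} (hc : c ≠ 0) (hq : IsQuadratic q)
    (h : ∀ x, (x + a ∈ V → f x = c * phase (q x)) ∧ (x + a ∉ V → f x = 0)) {i : Fin n}
    (hi : Pi.single i 1 ∈ V) (hne : act (RandomStab.gateH i) f ≠ 0) :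
    IsStabVec (act (RandomStab.gateH i) f) := by
  set e : Bits n := Pi.single i 1 with he
  obtain ⟨c₀, l, hl⟩ := hq.exists_increment e
  let p : Bits n →ₗ[ZMod 2] ZMod 2 := LinearMap.proj i
  have hr := inv_sqrt_two_ne_zero
  have hsum : ∀ x, x + a ∈ V → act (RandomStab.gateH i) f x = ((Real.sqrt 2 : ℝ) : ℂ)⁻¹ * c *
      phase (q x + 2 * lift (x i)) * (1 + phase (c₀ + 2 * lift ((l + p) x))) := fun x hx => by
    have hx' : x + e + a ∈ V := by
      rw [add_right_comm]; exact V.add_mem hx hi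
    rw [act_gateH', ← he, (h x).1 hx, (h (x + e)).1 hx', hl]
    have h2 : 2 * lift (x i) + (c₀ + 2 * lift ((l + p) x)) = c₀ + 2 * lift (l x) := by
      rw [LinearMap.add_apply, two_mul_lift_add]
      have : p x = x i := rfl
      rw [this]
      have h4 : ∀ b : ZMod 2, 2 * lift b + 2 * lift b = 0 := by decide
      linear_combination h4 (x i)
    rw [← h2]
    simp only [phase_add]
    ring
  have hzero : ∀ x, x + a ∉ V → act (RandomStab.gateH i) f x = 0 := fun x hx => by
    have hx' : x + e + a ∉ V := fun hm => hx <| by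
      rw [add_right_comm] at hm
      exact (V.add_mem_iff_left hi).1 hm
    rw [act_gateH', ← he, (h x).2 hx, (h (x + e)).2 hx']
    ring
  have hq' : IsQuadratic fun x : Bits n => q x + 2 * lift (x i) := by
    refine hq.add ?_
    have h2 := (isQuadratic_lift p 0).const_mul 2
    simp only [add_zero] at h2
    exact h2
  rcases zmod_four_odd_or_even c₀ with hodd | ⟨t, rfl⟩
  · refine ⟨((Real.sqrt 2 : ℝ) : ℂ)⁻¹ * c * (1 + phase c₀), V, a,
      fun x => q x + 2 * lift (x i) + -c₀ * lift ((l + p) x),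
      mul_ne_zero (mul_ne_zero hr hc) (one_add_phase_odd hodd 0).2, ?_,
      fun x => ⟨fun hx => ?_, hzero x⟩⟩
    · refine hq'.add ?_
      simpa using (isQuadratic_lift (l + p) 0).const_mul (-c₀)
    · rw [hsum x hx, (one_add_phase_odd hodd _).1, phase_add _ (-c₀ * _)]
      ring
  · obtain ⟨b, hb⟩ := Function.ne_iff.1 hne
    have hbV : b + a ∈ V := by
      by_contra hbV
      exact hb (hzero b hbV)
    have hbt : (l + p) b = t := by
      by_contra hbt
      exact hb (by rw [hsum b hbV, (one_add_phase_even t _).2 hbt, mul_zero, Pi.zero_apply])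
    have hmem : ∀ x, x + b ∈ V ↔ x + a ∈ V := fun x => by
      rw [← V.add_mem_iff_left hbV, add_assoc, ← add_assoc b, ZModModule.add_self, zero_add]
    have hker : ∀ x, x + b ∈ LinearMap.ker (l + p) ↔ (l + p) x = t := fun x => by
      rw [LinearMap.mem_ker, map_add, hbt, ← ZModModule.sub_eq_add, sub_eq_zero]
    refine ⟨((Real.sqrt 2 : ℝ) : ℂ)⁻¹ * c * 2, V ⊓ LinearMap.ker (l + p), b, _,
      mul_ne_zero (mul_ne_zero hr hc) two_ne_zero, hq', fun x => ?_⟩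
    rw [Submodule.mem_inf, hmem, hker]
    refine ⟨fun ⟨hx, hxt⟩ => ?_, fun hx => ?_⟩
    · rw [hsum x hx, (one_add_phase_even t _).1 hxt]
      ring
    · by_cases hxV : x + a ∈ V
      · rw [hsum x hxV, (one_add_phase_even t _).2 (fun hxt => hx ⟨hxV, hxt⟩), mul_zero]
      · exact hzero x hxV

theorem IsStabVec.gateH {f : Bits n → ℂ} (hf : IsStabVec f) (i : Fin n) :
    IsStabVec (act (gateH i) f) := by
  have hne := act_ne_zero (RandomStab.gateH i) hf.ne_zero
  obtain ⟨c, V, a, q, hc, hq, h⟩ := hf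
  by_cases hi : (Pi.single i 1 : Bits n) ∈ V
  · exact gateH_of_mem hc hq h hi hne
  · exact gateH_of_notMem hc hq h hi

theorem IsStabVec.act_clifford {U : Op n} (hU : U ∈ cliffordGroup n) {f : Bits n → ℂ}
    (hf : IsStabVec f) : IsStabVec (act U f) := by
  induction hU using Subgroup.closure_induction'' generalizing f with
  | mem x hx =>
    rcases hx with (⟨i, rfl⟩ | ⟨i, rfl⟩) | ⟨i, j, h, rfl⟩
    · exact hf.gateH i
    · exact hf.gateS i
    · exact hf.gateCNOT i j h
  | inv_mem x hx =>
    -- The generators have finite order, so their inverses are powers of generators.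
    rcases hx with (⟨i, rfl⟩ | ⟨i, rfl⟩) | ⟨i, j, h, rfl⟩
    · rw [inv_eq_of_mul_eq_one_right (gateH_mul_self i)]
      exact hf.gateH i
    · rw [inv_eq_of_mul_eq_one_right (gateS_pow_four i), act_mul, act_mul]
      exact ((hf.gateS i).gateS i).gateS i
    · rw [inv_eq_of_mul_eq_one_right (gateCNOT_mul_self i j h)]
      exact hf.gateCNOT i j h
  | one => rwa [act_one]
  | mul x y _ _ hx hy =>
    rw [act_mul]
    exact hx (hy hf)

/-! ### The state vectors prepared by the circuits -/

theorem act_foldl (c : List (Op n)) (U : Op n) (f : Bits n → ℂ) :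
    act (c.foldl (fun U g => g * U) U) f = c.foldl (fun h g => act g h) (act U f) := by
  induction c generalizing U with
  | nil => rfl
  | cons g c ih => rw [List.foldl_cons, List.foldl_cons, ih, act_mul]

theorem act_circuitOp (c : List (Op n)) (f : Bits n → ℂ) :
    act (circuitOp c) f = c.foldl (fun h g => act g h) f := by
  rw [circuitOp, act_foldl, act_one]

theorem act_circuitOp_nil (f : Bits n → ℂ) : act (circuitOp []) f = f := by
  rw [act_circuitOp, List.foldl_nil]

theorem act_circuitOp_singleton (g : Op n) (f : Bits n → ℂ) : act (circuitOp [g]) f = act g f := by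
  rw [act_circuitOp, List.foldl_cons, List.foldl_nil]

theorem act_circuitOp_append (c d : List (Op n)) (f : Bits n → ℂ) :
    act (circuitOp (c ++ d)) f = act (circuitOp d) (act (circuitOp c) f) := by
  simp only [act_circuitOp, List.foldl_append]

theorem circuitOp_mem {c : List (Op n)} {G : Subgroup (Op n)} (h : ∀ g ∈ c, g ∈ G) :
    circuitOp c ∈ G := by
  have key : ∀ (c : List (Op n)) (U : Op n), U ∈ G → (∀ g ∈ c, g ∈ G) →
      c.foldl (fun U g => g * U) U ∈ G := by
    intro c
    induction c with
    | nil => exact fun U hU _ => hU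
    | cons g c ih =>
      intro U hU h
      exact ih _ (mul_mem (h g (by simp)) hU) fun g' hg' => h g' (by simp [hg'])
  exact key c 1 (one_mem G) h

/-- A sequence of blocks of diagonal gates: the phases add up. -/
theorem act_flatMap_diagonal {α : Type*} (F : α → List (Op n)) (w : α → Bits n → ZMod 4)
    (h : ∀ i f x, act (circuitOp (F i)) f x = phase (w i x) * f x) (l : List α) (f : Bits n → ℂ)
    (x : Bits n) :
    act (circuitOp (l.flatMap F)) f x = phase (l.map fun i => w i x).sum * f x := by
  induction l generalizing f with
  | nil => simp [act_circuitOp_nil]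
  | cons i l ih =>
    rw [List.flatMap_cons, act_circuitOp_append, ih, h, List.map_cons, List.sum_cons, phase_add]
    ring

/-- A sequence of blocks of gates that act by translations `x ↦ x + v i x`, where no block changes
the bits that control the translations of the others: the translations add up. -/
theorem act_flatMap_translation {α : Type*} (F : α → List (Op n)) (v : α → Bits n → Bits n)
    (h : ∀ i f x, act (circuitOp (F i)) f x = f (x + v i x))
    (hv : ∀ i j x y, v i (x + v j y) = v i x) (l : List α) (f : Bits n → ℂ) (x : Bits n) :
    act (circuitOp (l.flatMap F)) f x = f (x + (l.map fun i => v i x).sum) := by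
  induction l generalizing f x with
  | nil => simp [act_circuitOp_nil]
  | cons i l ih =>
    have hsum : ∀ l : List α, v i (x + (l.map fun j => v j x).sum) = v i x := by
      intro l
      induction l with
      | nil => simp
      | cons j l ihl =>
        rw [List.map_cons, List.sum_cons, add_left_comm, add_comm, hv, ihl]
    rw [List.flatMap_cons, act_circuitOp_append, ih, h, List.map_cons, List.sum_cons, hsum,
      add_assoc, add_comm (List.sum _)]

theorem act_layer_diagonal {gate : Fin n → Op n} {w : Fin n → Bits n → ZMod 4}
    (h : ∀ i f x, act (gate i) f x = phase (w i x) * f x) (A : Finset (Fin n)) (f : Bits n → ℂ)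
    (x : Bits n) : act (circuitOp (layer gate A)) f x = phase (∑ i ∈ A, w i x) * f x := by
  rw [layer, act_flatMap_diagonal _ fun i x => if i ∈ A then w i x else 0]
  · rw [← Fin.sum_univ_def, Finset.sum_ite_mem, Finset.univ_inter]
  · intro i f x
    split_ifs
    · rw [act_circuitOp_singleton, h]
    · rw [act_circuitOp_nil, phase_zero, one_mul]

/-- The bit string with ones exactly at the positions in `A`. -/
def indicator (A : Finset (Fin n)) : Bits n := fun i => if i ∈ A then 1 else 0

theorem indicator_injective : Function.Injective (indicator : Finset (Fin n) → Bits n) := by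
  intro A A' h
  ext i
  have := congrFun h i
  by_cases h1 : i ∈ A <;> by_cases h2 : i ∈ A' <;> simp_all [indicator]

theorem indicator_eq_sum (A : Finset (Fin n)) :
    indicator A = ∑ i, if i ∈ A then (Pi.single i 1 : Bits n) else 0 := by
  funext j
  rw [Finset.sum_apply, Finset.sum_eq_single j]
  · by_cases h : j ∈ A <;> simp [indicator, h]
  · intro i _ hij
    split_ifs
    · simp [hij.symm]
    · rfl
  · simp

theorem act_layer_gateX (A : Finset (Fin n)) (f : Bits n → ℂ) (x : Bits n) :
    act (circuitOp (layer gateX A)) f x = f (x + indicator A) := by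
  rw [layer, act_flatMap_translation _ fun i _ => if i ∈ A then Pi.single i 1 else 0]
  · rw [← Fin.sum_univ_def, ← indicator_eq_sum]
  · intro i f x
    split_ifs
    · rw [act_circuitOp_singleton, act_gateX]
    · rw [act_circuitOp_nil, add_zero]
  · intros; rfl

theorem act_czLayer (C : Finset (Fin n × Fin n)) (f : Bits n → ℂ) (x : Bits n) :
    act (circuitOp (czLayer C)) f x = phase (∑ p ∈ C, 2 * lift (x p.1 * x p.2)) * f x := by
  rw [czLayer, act_flatMap_diagonal _
    fun i x => ∑ j, if (i, j) ∈ C then 2 * lift (x i * x j) else 0]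
  · rw [← Fin.sum_univ_def, ← Fintype.sum_prod_type'
      (f := fun i j => if (i, j) ∈ C then 2 * lift (x i * x j) else 0)]
    simp only [Prod.mk.eta]
    rw [Finset.sum_ite_mem, Finset.univ_inter]
  · intro i f x
    rw [act_flatMap_diagonal _ fun j x => if (i, j) ∈ C then 2 * lift (x i * x j) else 0]
    · rw [← Fin.sum_univ_def]
    · intro j f x
      split_ifs
      · rw [act_circuitOp_singleton, act_gateCZ]
      · rw [act_circuitOp_nil, phase_zero, one_mul]

/-- Hadamard gates on distinct qubits, all in state `|0⟩`, create a uniform superposition. -/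
theorem exists_act_hadamard_list (T : Finset (Fin n)) (l : List (Fin n)) (hl : l.Nodup)
    (S : Finset (Fin n)) (hS : ∀ i ∈ l, i ∉ S) (f : Bits n → ℂ) (c : ℂ) (hc : c ≠ 0)
    (hf : ∀ x, ((∀ j, j ∉ S → x j = 0) → f x = c) ∧ (¬ (∀ j, j ∉ S → x j = 0) → f x = 0)) :
    ∃ c' : ℂ, c' ≠ 0 ∧ ∀ x,
      ((∀ j, j ∉ S → ¬ (j ∈ l ∧ j ∈ T) → x j = 0) →
        act (circuitOp (l.flatMap fun i => if i ∈ T then [gateH i] else [])) f x = c') ∧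
      (¬ (∀ j, j ∉ S → ¬ (j ∈ l ∧ j ∈ T) → x j = 0) →
        act (circuitOp (l.flatMap fun i => if i ∈ T then [gateH i] else [])) f x = 0) := by
  induction l generalizing S f c with
  | nil => exact ⟨c, hc, by simpa [act_circuitOp_nil] using hf⟩
  | cons i l ih =>
    rw [List.nodup_cons] at hl
    simp only [List.flatMap_cons, act_circuitOp_append]
    by_cases hi : i ∈ T
    · rw [if_pos hi, act_circuitOp_singleton]
      have hr := inv_sqrt_two_ne_zero
      have hiS := hS i (by simp)
      obtain ⟨c', hc', h⟩ := ih hl.2 (insert i S) (fun j hj => by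
          rw [Finset.mem_insert, not_or]
          exact ⟨fun hji => hl.1 (hji ▸ hj), hS j (by simp [hj])⟩)
        (act (gateH i) f) (((Real.sqrt 2 : ℝ) : ℂ)⁻¹ * c) (mul_ne_zero hr hc) (fun x => by
          have h1 : f (Function.update x i 1) = 0 := (hf _).2 fun h => by
            simpa using h i hiS
          have h0 : (∀ j, j ∉ S → Function.update x i 0 j = 0) ↔ ∀ j, j ∉ insert i S → x j = 0 := by
            refine forall_congr' fun j => ?_
            by_cases hj : j = i
            · subst hj; simp
            · simp [hj]
          rw [act_gateH, h1, mul_zero, add_zero, ← h0]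
          exact ⟨fun h => by rw [(hf _).1 h], fun h => by rw [(hf _).2 h, mul_zero]⟩)
      refine ⟨c', hc', fun x => ?_⟩
      have hiff : (∀ j, j ∉ S → ¬ (j ∈ i :: l ∧ j ∈ T) → x j = 0) ↔
          ∀ j, j ∉ insert i S → ¬ (j ∈ l ∧ j ∈ T) → x j = 0 := by
        refine forall_congr' fun j => ?_
        by_cases hj : j = i
        · subst hj; simp [hi]
        · simp [hj]
      rw [hiff]
      exact h x
    · rw [if_neg hi, act_circuitOp_nil]
      obtain ⟨c', hc', h⟩ := ih hl.2 S (fun j hj => hS j (by simp [hj])) f c hc hf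
      refine ⟨c', hc', fun x => ?_⟩
      have hiff : (∀ j, j ∉ S → ¬ (j ∈ i :: l ∧ j ∈ T) → x j = 0) ↔
          ∀ j, j ∉ S → ¬ (j ∈ l ∧ j ∈ T) → x j = 0 := by
        refine forall_congr' fun j => ?_
        by_cases hj : j = i
        · subst hj; simp [hi]
        · simp [hj]
      rw [hiff]
      exact h x

theorem exists_act_layer_gateH (T : Finset (Fin n)) :
    ∃ c : ℂ, c ≠ 0 ∧ ∀ x,
      ((∀ j, j ∉ T → x j = 0) → act (circuitOp (layer gateH T)) (ketZero n) x = c) ∧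
      (¬ (∀ j, j ∉ T → x j = 0) → act (circuitOp (layer gateH T)) (ketZero n) x = 0) := by
  obtain ⟨c, hc, h⟩ := exists_act_hadamard_list T (List.finRange n) (List.nodup_finRange n) ∅
    (by simp) (ketZero n) 1 one_ne_zero fun x => by
      have : (∀ j, j ∉ (∅ : Finset (Fin n)) → x j = 0) ↔ x = 0 := by simp [funext_iff]
      rw [this]
      exact ⟨fun h => by simp [ketZero, h], fun h => by simp [ketZero, h]⟩
  refine ⟨c, hc, fun x => ?_⟩
  simpa [layer] using h x

/-! ### Coordinates on a subspace given by the pivot columns -/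

section RREF

variable (V : Submodule (ZMod 2) (Bits n))

theorem rref_mem (r : Fin (Module.finrank (ZMod 2) V)) : rref V r ∈ V :=
  (isRREF_rref V).span_rows.le (Submodule.subset_span ⟨r, rfl⟩)

theorem rref_apply_pivot (r s : Fin (Module.finrank (ZMod 2) V)) :
    rref V r (pivot V s) = if r = s then 1 else 0 := by
  split_ifs with h
  · rw [h, (isRREF_rref V).pivot_eq_one]
  · exact (isRREF_rref V).pivot_column s r h

theorem pivot_injective : Function.Injective (pivot V) :=
  (isRREF_rref V).strictMono_pivot.injective

theorem mem_iff_eq_sum_rref (v : Bits n) : v ∈ V ↔ v = ∑ r, v (pivot V r) • rref V r := by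
  constructor
  · intro hv
    rw [← (isRREF_rref V).span_rows, Submodule.mem_span_range_iff_exists_fun] at hv
    obtain ⟨c, rfl⟩ := hv
    refine Finset.sum_congr rfl fun r _ => ?_
    congr 1
    simp [rref_apply_pivot]
  · intro hv
    rw [hv]
    exact Submodule.sum_mem _ fun r _ => Submodule.smul_mem _ _ (rref_mem V r)

theorem card_pivotSet : (pivotSet V).card = Module.finrank (ZMod 2) V := by
  rw [pivotSet, Finset.card_image_of_injective _ (pivot_injective V), Finset.card_univ,
    Fintype.card_fin]

theorem mem_pivotSet {i : Fin n} : i ∈ pivotSet V ↔ ∃ r, pivot V r = i := by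
  simp [pivotSet]

/-- A vector of `V` is determined by its bits at the pivots, which can be prescribed. -/
theorem exists_pivot_basis : ∃ R : Fin n → Bits n, (∀ i, R i ∈ V) ∧
    (∀ i ∈ pivotSet V, ∀ j ∈ pivotSet V, R i j = if i = j then 1 else 0) ∧
    ∀ v ∈ V, v = ∑ i ∈ pivotSet V, v i • R i := by
  classical
  have hex : ∀ i, ∃ w ∈ V, ∀ r, pivot V r = i → w = rref V r := fun i => by
    by_cases h : ∃ r, pivot V r = i
    · obtain ⟨r, rfl⟩ := h
      exact ⟨rref V r, rref_mem V r, fun s hs => by rw [pivot_injective V hs]⟩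
    · exact ⟨0, V.zero_mem, fun r hr => absurd ⟨r, hr⟩ h⟩
  choose R hRV hR using hex
  refine ⟨R, hRV, fun i hi j hj => ?_, fun v hv => ?_⟩
  · obtain ⟨r, rfl⟩ := (mem_pivotSet V).1 hi
    obtain ⟨s, rfl⟩ := (mem_pivotSet V).1 hj
    rw [hR _ r rfl, rref_apply_pivot]
    simp only [(pivot_injective V).eq_iff]
  · rw [pivotSet, Finset.sum_image fun r _ s _ h => pivot_injective V h]
    conv_lhs => rw [(mem_iff_eq_sum_rref V v).1 hv]
    exact Finset.sum_congr rfl fun r _ => by rw [hR _ r rfl]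

theorem eq_zero_of_pivotSet {v : Bits n} (hv : v ∈ V) (h : ∀ i ∈ pivotSet V, v i = 0) : v = 0 := by
  obtain ⟨R, _, _, hR⟩ := exists_pivot_basis V
  rw [hR v hv]
  exact Finset.sum_eq_zero fun i hi => by rw [h i hi, zero_smul]

/-- The part of a row of `rref V` to the right of its pivot. -/
theorem sum_rref_targets (r : Fin (Module.finrank (ZMod 2) V)) :
    (∑ j, if pivot V r < j ∧ rref V r j = 1 then (Pi.single j 1 : Bits n) else 0) =
      rref V r + Pi.single (pivot V r) 1 := by
  funext k
  rw [Finset.sum_apply, Finset.sum_eq_single k]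
  · rw [Pi.add_apply]
    rcases lt_trichotomy (pivot V r) k with h | h | h
    · rcases zmod_two_cases (rref V r k) with h0 | h1
      · simp [h0, h.ne']
      · simp [h, h1, h.ne']
    · subst h
      have : (1 + 1 : ZMod 2) = 0 := rfl
      simp [(isRREF_rref V).pivot_eq_one, this]
    · simp [(isRREF_rref V).left_of_pivot r k h, h.ne, h.not_gt]
  · intro j _ hjk
    split_ifs
    · simp [hjk.symm]
    · rfl
  · simp

theorem act_cnotLayer (f : Bits n → ℂ) (x : Bits n) :
    act (circuitOp (cnotLayer V)) f x =
      f (x + ∑ r, x (pivot V r) • (rref V r + Pi.single (pivot V r) 1)) := by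
  rw [cnotLayer, act_flatMap_translation _
    fun r x => x (pivot V r) • (rref V r + Pi.single (pivot V r) 1), ← Fin.sum_univ_def]
  · intro r f x
    rw [act_flatMap_translation _
      fun j x => if pivot V r < j ∧ rref V r j = 1 then x (pivot V r) • Pi.single j 1 else 0]
    · rw [← Fin.sum_univ_def, ← sum_rref_targets, Finset.smul_sum]
      simp only [smul_ite, smul_zero]
    · intro j f x
      split_ifs
      · rw [act_circuitOp_singleton, act_gateCNOT]
      · rw [act_circuitOp_nil, add_zero]
    · intro j k x y
      have h : (if pivot V r < k ∧ rref V r k = 1 then y (pivot V r) • (Pi.single k 1 : Bits n)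
          else 0) (pivot V r) = 0 := by
        split_ifs with h
        · simp [h.1.ne]
        · rfl
      simp only [Pi.add_apply, h, add_zero]
  · intro r s x y
    have h : (rref V s + Pi.single (pivot V s) 1 : Bits n) (pivot V r) = 0 := by
      rw [Pi.add_apply, rref_apply_pivot]
      by_cases hrs : r = s
      · subst hrs
        have : (1 + 1 : ZMod 2) = 0 := rfl
        simp [this]
      · have : pivot V r ≠ pivot V s := fun h => hrs (pivot_injective V h)
        simp [this, Ne.symm hrs]
    simp only [Pi.add_apply, Pi.smul_apply] at h ⊢
    simp only [h, smul_zero, add_zero]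

/-- The `CNOT` gates turn the uniform superposition of the bit strings supported on the pivots into
that of the vectors of `V`. -/
theorem cnot_support_iff (x : Bits n) :
    (∀ j, j ∉ pivotSet V →
      (x + ∑ r, x (pivot V r) • (rref V r + Pi.single (pivot V r) 1)) j = 0) ↔ x ∈ V := by
  have hoff : ∀ j, j ∉ pivotSet V →
      (x + ∑ r, x (pivot V r) • (rref V r + Pi.single (pivot V r) 1)) j =
        (x + ∑ r, x (pivot V r) • rref V r) j := fun j hj => by
    simp only [Pi.add_apply, Finset.sum_apply, Pi.smul_apply]
    congr 1
    refine Finset.sum_congr rfl fun r _ => ?_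
    rw [Pi.single_eq_of_ne (fun h => hj ((mem_pivotSet V).2 ⟨r, h.symm⟩)), add_zero]
  have hon : ∀ j, j ∈ pivotSet V → (x + ∑ r, x (pivot V r) • rref V r) j = 0 := fun j hj => by
    obtain ⟨s, rfl⟩ := (mem_pivotSet V).1 hj
    simp [rref_apply_pivot, ZModModule.add_self]
  rw [mem_iff_eq_sum_rref, ← sub_eq_zero, ZModModule.sub_eq_add]
  constructor
  · intro h
    funext j
    by_cases hj : j ∈ pivotSet V
    · exact hon j hj
    · rw [← hoff j hj, h j hj, Pi.zero_apply]
  · intro h j hj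
    rw [hoff j hj, h, Pi.zero_apply]

end RREF

/-! ### The circuit for given random choices -/

/-- The exponent of `i` in the amplitude of `|x⟩` after the gates `S` on `B`, `Z` on `D` and `CZ` on
`C`. -/
def phaseForm (B D : Finset (Fin n)) (C : Finset (Fin n × Fin n)) (x : Bits n) : ZMod 4 :=
  ∑ i ∈ B, lift (x i) + ∑ i ∈ D, 2 * lift (x i) + ∑ p ∈ C, 2 * lift (x p.1 * x p.2)

/-- The circuit that the algorithm applies to `|0ⁿ⟩` for given values of its random choices. -/
noncomputable def circuit (V : Submodule (ZMod 2) (Bits n)) (A B D : Finset (Fin n))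
    (C : Finset (Fin n × Fin n)) : Op n :=
  circuitOp (layer gateH (pivotSet V) ++ cnotLayer V ++ layer gateX A ++ layer gateS B ++
    layer gateZ D ++ czLayer C)

theorem exists_act_circuit (V : Submodule (ZMod 2) (Bits n)) (A B D : Finset (Fin n))
    (C : Finset (Fin n × Fin n)) : ∃ c : ℂ, c ≠ 0 ∧ ∀ x,
      (x + indicator A ∈ V →
        act (circuit V A B D C) (ketZero n) x = c * phase (phaseForm B D C x)) ∧
      (x + indicator A ∉ V → act (circuit V A B D C) (ketZero n) x = 0) := by
  obtain ⟨c, hc, h⟩ := exists_act_layer_gateH (pivotSet V)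
  refine ⟨c, hc, fun x => ?_⟩
  have h' := h (x + indicator A + ∑ r, (x + indicator A) (pivot V r) •
    (rref V r + Pi.single (pivot V r) 1))
  rw [cnot_support_iff] at h'
  have hx : act (circuit V A B D C) (ketZero n) x = phase (phaseForm B D C x) *
      act (circuitOp (layer gateH (pivotSet V))) (ketZero n) (x + indicator A +
        ∑ r, (x + indicator A) (pivot V r) • (rref V r + Pi.single (pivot V r) 1)) := by
    rw [circuit, act_circuitOp_append, act_circuitOp_append, act_circuitOp_append,
      act_circuitOp_append, act_circuitOp_append, act_czLayer, act_layer_diagonal act_gateZ,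
      act_layer_diagonal act_gateS, act_layer_gateX, act_cnotLayer, phaseForm, phase_add, phase_add]
    ring
  rw [hx]
  exact ⟨fun hm => by rw [h'.1 hm, mul_comm], fun hm => by rw [h'.2 hm, mul_zero]⟩

theorem circuit_mem (V : Submodule (ZMod 2) (Bits n)) (A B D : Finset (Fin n))
    {C : Finset (Fin n × Fin n)} (hC : C ⊆ pairs (pivotSet V)) :
    circuit V A B D C ∈ cliffordGroup n := by
  have hlayer : ∀ {gate : Fin n → Op n} {A : Finset (Fin n)}, (∀ i, gate i ∈ cliffordGroup n) →
      ∀ g ∈ layer gate A, g ∈ cliffordGroup n := by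
    intro gate A h g hg
    rw [layer, List.mem_flatMap] at hg
    obtain ⟨i, _, hi⟩ := hg
    split_ifs at hi
    · rw [List.mem_singleton.1 hi]; exact h i
    · simp at hi
  refine circuitOp_mem fun g hg => ?_
  simp only [List.mem_append] at hg
  rcases hg with ((((hg | hg) | hg) | hg) | hg) | hg
  · exact hlayer gateH_mem g hg
  · rw [cnotLayer, List.mem_flatMap] at hg
    obtain ⟨r, _, hg⟩ := hg
    rw [List.mem_flatMap] at hg
    obtain ⟨j, _, hg⟩ := hg
    split_ifs at hg
    · rw [List.mem_singleton.1 hg]; exact gateCNOT_mem _ _ _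
    · simp at hg
  · exact hlayer gateX_mem g hg
  · exact hlayer gateS_mem g hg
  · exact hlayer gateZ_mem g hg
  · rw [czLayer, List.mem_flatMap] at hg
    obtain ⟨i, _, hg⟩ := hg
    rw [List.mem_flatMap] at hg
    obtain ⟨j, _, hg⟩ := hg
    split_ifs at hg with hij
    · rw [List.mem_singleton.1 hg]
      have := hC hij
      rw [pairs, Finset.mem_filter] at this
      exact gateCZ_mem this.2.ne
    · simp at hg

/-! ### Every stabilizer state is prepared by exactly one circuit -/

theorem phaseForm_congr {T B D : Finset (Fin n)} {C : Finset (Fin n × Fin n)} (hB : B ⊆ T)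
    (hD : D ⊆ T) (hC : C ⊆ pairs T) {x y : Bits n} (h : ∀ i ∈ T, x i = y i) :
    phaseForm B D C x = phaseForm B D C y := by
  rw [phaseForm, phaseForm]
  congr 1
  · congr 1
    · exact Finset.sum_congr rfl fun i hi => by rw [h i (hB hi)]
    · exact Finset.sum_congr rfl fun i hi => by rw [h i (hD hi)]
  · refine Finset.sum_congr rfl fun p hp => ?_
    have hp' := Finset.mem_product.1 (Finset.mem_filter.1 (hC hp)).1
    rw [h _ hp'.1, h _ hp'.2]

theorem phaseForm_zero (B D : Finset (Fin n)) (C : Finset (Fin n × Fin n)) :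
    phaseForm B D C 0 = 0 := by
  simp [phaseForm]

theorem phaseForm_single_eq_sum {B D T : Finset (Fin n)} {C : Finset (Fin n × Fin n)}
    (hC : C ⊆ pairs T) (k : Fin n) : phaseForm B D C (Pi.single k 1) =
      ∑ i ∈ B, lift ((Pi.single k 1 : Bits n) i) +
        ∑ i ∈ D, 2 * lift ((Pi.single k 1 : Bits n) i) := by
  rw [phaseForm, Finset.sum_eq_zero (s := C), add_zero]
  intro p hp
  have hlt := (Finset.mem_filter.1 (hC hp)).2
  by_cases h : k = p.1
  · subst h; simp [hlt.ne']
  · simp [Ne.symm h]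

theorem phaseForm_single {B D T : Finset (Fin n)} {C : Finset (Fin n × Fin n)} (hC : C ⊆ pairs T)
    (k : Fin n) : phaseForm B D C (Pi.single k 1) =
      (if k ∈ B then 1 else 0) + if k ∈ D then 2 else 0 := by
  have h1 : ∀ i, lift ((Pi.single k 1 : Bits n) i) = if k = i then 1 else 0 := fun i => by
    by_cases h : k = i
    · subst h; simp
    · simp [h, Ne.symm h]
  rw [phaseForm_single_eq_sum hC]
  simp [h1]

theorem phaseForm_single_add_single {B D T : Finset (Fin n)} {C : Finset (Fin n × Fin n)}
    (hC : C ⊆ pairs T) {k l : Fin n} (hkl : k < l) :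
    phaseForm B D C (Pi.single k 1 + Pi.single l 1) = phaseForm B D C (Pi.single k 1) +
      phaseForm B D C (Pi.single l 1) + if (k, l) ∈ C then 2 else 0 := by
  have h1 : ∀ i, lift ((Pi.single k 1 + Pi.single l 1 : Bits n) i) =
      lift ((Pi.single k 1 : Bits n) i) + lift ((Pi.single l 1 : Bits n) i) := fun i => by
    rw [Pi.add_apply, lift_add]
    by_cases h : k = i
    · subst h; simp [hkl.ne]
    · simp [Ne.symm h]
  have h2 : ∀ p ∈ C, 2 * lift ((Pi.single k 1 + Pi.single l 1 : Bits n) p.1 *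
      (Pi.single k 1 + Pi.single l 1 : Bits n) p.2) = if (k, l) = p then 2 else 0 := by
    rintro ⟨i, j⟩ hp
    have hlt : i < j := (Finset.mem_filter.1 (hC hp)).2
    simp only [Prod.mk.injEq, Pi.add_apply]
    by_cases hi : k = i
    · subst hi
      by_cases hj : l = j
      · subst hj; simp [hkl.ne, hkl.ne']
      · simp [hj, Ne.symm hj, hlt.ne']
    · by_cases hi' : l = i
      · subst hi'
        simp [hi, (hkl.trans hlt).ne', hlt.ne']
      · simp [hi, Ne.symm hi, Ne.symm hi']
  rw [phaseForm_single_eq_sum hC, phaseForm_single_eq_sum hC, phaseForm,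
    Finset.sum_congr rfl h2, Finset.sum_ite_eq]
  simp only [h1, mul_add, Finset.sum_add_distrib]
  ring

/-- The quadratic form determines the random choices that produce it. -/
theorem phaseForm_injective {T B D B' D' : Finset (Fin n)} {C C' : Finset (Fin n × Fin n)}
    (hC : C ⊆ pairs T) (hC' : C' ⊆ pairs T)
    (h : ∀ y, phaseForm B D C y = phaseForm B' D' C' y) : B = B' ∧ D = D' ∧ C = C' := by
  have key : ∀ k, (k ∈ B ↔ k ∈ B') ∧ (k ∈ D ↔ k ∈ D') := fun k => by
    have := h (Pi.single k 1)
    rw [phaseForm_single hC, phaseForm_single hC'] at this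
    have e : (1 + 2 : ZMod 4) = 3 := rfl
    by_cases h1 : k ∈ B <;> by_cases h2 : k ∈ D <;> by_cases h3 : k ∈ B' <;>
      by_cases h4 : k ∈ D' <;>
      simp only [h1, h2, h3, h4, if_true, if_false, add_zero, zero_add, e] at this ⊢ <;>
      first | exact ⟨Iff.rfl, Iff.rfl⟩ | (revert this; decide)
  refine ⟨Finset.ext fun k => (key k).1, Finset.ext fun k => (key k).2, Finset.ext ?_⟩
  rintro ⟨k, l⟩
  by_cases hkl : k < l
  · have := h (Pi.single k 1 + Pi.single l 1)
    rw [phaseForm_single_add_single hC hkl, phaseForm_single_add_single hC' hkl, h, h,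
      add_right_inj] at this
    by_cases h1 : (k, l) ∈ C <;> by_cases h2 : (k, l) ∈ C' <;>
      simp only [h1, h2, if_true, if_false] at this ⊢ <;> (revert this; decide)
  · exact ⟨fun hp => absurd (Finset.mem_filter.1 (hC hp)).2 hkl,
      fun hp => absurd (Finset.mem_filter.1 (hC' hp)).2 hkl⟩

theorem prepared_eq_iff (U W : Op n) :
    prepared U = prepared W ↔ ∃ a : ℂ, a • act W (ketZero n) = act U (ketZero n) := by
  rw [prepared, prepared, Projectivization.mk_eq_mk_iff']
  rfl

/-- The state determines the subspace, the translation and the phases. -/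
theorem circuit_injective {V V' : Submodule (ZMod 2) (Bits n)} {A B D A' B' D' : Finset (Fin n)}
    {C C' : Finset (Fin n × Fin n)} (hA : A ⊆ (pivotSet V)ᶜ) (hB : B ⊆ pivotSet V)
    (hD : D ⊆ pivotSet V) (hC : C ⊆ pairs (pivotSet V)) (hA' : A' ⊆ (pivotSet V')ᶜ)
    (hB' : B' ⊆ pivotSet V') (hD' : D' ⊆ pivotSet V') (hC' : C' ⊆ pairs (pivotSet V'))
    (h : prepared (circuit V A B D C) = prepared (circuit V' A' B' D' C')) :
    V = V' ∧ A = A' ∧ B = B' ∧ D = D' ∧ C = C' := by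
  rw [prepared_eq_iff] at h
  obtain ⟨a, ha⟩ := h
  obtain ⟨c, hc, hf⟩ := exists_act_circuit V A B D C
  obtain ⟨c', hc', hf'⟩ := exists_act_circuit V' A' B' D' C'
  have hval : ∀ x, act (circuit V A B D C) (ketZero n) x =
      a * act (circuit V' A' B' D' C') (ketZero n) x := fun x => by rw [← ha]; rfl
  have ha0 : a ≠ 0 := by
    rintro rfl
    have h1 := hval (indicator A)
    rw [(hf _).1 (by rw [ZModModule.add_self]; exact V.zero_mem), zero_mul] at h1
    exact mul_ne_zero hc (phase_ne_zero _) h1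
  have hsupp : ∀ x, x + indicator A ∈ V ↔ x + indicator A' ∈ V' := fun x => by
    constructor <;> intro hx <;> by_contra hx'
    · have h1 := hval x
      rw [(hf x).1 hx, (hf' x).2 hx', mul_zero] at h1
      exact mul_ne_zero hc (phase_ne_zero _) h1
    · have h1 := hval x
      rw [(hf x).2 hx', (hf' x).1 hx] at h1
      exact mul_ne_zero ha0 (mul_ne_zero hc' (phase_ne_zero _)) h1.symm
  have hAA : indicator A + indicator A' ∈ V' := by
    rw [← hsupp, ZModModule.add_self]; exact V.zero_mem
  obtain rfl : V = V' := by
    ext v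
    have h1 := hsupp (v + indicator A)
    rw [add_assoc, ZModModule.add_self, add_zero, add_assoc] at h1
    rw [h1]
    exact V'.add_mem_iff_left hAA
  have hoff : ∀ {A : Finset (Fin n)}, A ⊆ (pivotSet V)ᶜ → ∀ i ∈ pivotSet V, indicator A i = 0 :=
    fun hA i hi => if_neg fun hiA => Finset.mem_compl.1 (hA hiA) hi
  obtain rfl : A = A' := by
    apply indicator_injective
    rw [← sub_eq_zero, ZModModule.sub_eq_add]
    exact eq_zero_of_pivotSet V hAA fun i hi => by
      rw [Pi.add_apply, hoff hA i hi, hoff hA' i hi, add_zero]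
  obtain ⟨R, hRV, hRp, -⟩ := exists_pivot_basis V
  -- Arbitrary bits at the pivots are realized by a vector in the support.
  have hphase : ∀ y : Bits n, c * phase (phaseForm B D C y) =
      a * (c' * phase (phaseForm B' D' C' y)) := fun y => by
    set v : Bits n := ∑ i ∈ pivotSet V, y i • R i with hv
    have hvV : v ∈ V := Submodule.sum_mem _ fun i _ => Submodule.smul_mem _ _ (hRV i)
    have hvy : ∀ j ∈ pivotSet V, (v + indicator A) j = y j := fun j hj => by
      rw [Pi.add_apply, hoff hA j hj, add_zero, hv, Finset.sum_apply, Finset.sum_eq_single j]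
      · simp [hRp j hj j hj]
      · intro i hi hij
        simp [hRp i hi j hj, hij]
      · exact fun hj' => absurd hj hj'
    have hm : v + indicator A + indicator A ∈ V := by
      rwa [add_assoc, ZModModule.add_self, add_zero]
    have h1 := hval (v + indicator A)
    rwa [(hf _).1 hm, (hf' _).1 hm, phaseForm_congr hB hD hC hvy,
      phaseForm_congr hB' hD' hC' hvy] at h1
  -- Both quadratic forms vanish at `0`, so the scalars agree.
  have hcc : c = a * c' := by
    simpa [phaseForm_zero] using hphase 0
  refine ⟨rfl, rfl, phaseForm_injective hC hC' fun y => phase_injective ?_⟩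
  have h1 := hphase y
  rw [← mul_assoc, ← hcc] at h1
  exact mul_left_cancel₀ hc h1

theorem zmod_four_mul_lift (b : ZMod 4) (a : ZMod 2) :
    b * lift a =
      (if b = 1 ∨ b = 3 then lift a else 0) + if b = 2 ∨ b = 3 then 2 * lift a else 0 := by
  revert b a; decide

/-- Every state vector with affine support and quadratic phase is prepared by one of the
circuits: the translation can be normalized to vanish on the pivots, and the quadratic function has
a polynomial form in the bits at the pivots. -/
theorem IsStabVec.exists_circuit {U : Op n} (hU : IsStabVec (act U (ketZero n))) :
    ∃ V : Submodule (ZMod 2) (Bits n), ∃ A ⊆ (pivotSet V)ᶜ, ∃ B ⊆ pivotSet V, ∃ D ⊆ pivotSet V,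
      ∃ C ⊆ pairs (pivotSet V), prepared U = prepared (circuit V A B D C) := by
  obtain ⟨c, V, a, q, hc, hq, hf⟩ := hU
  obtain ⟨R, hRV, hRp, hRs⟩ := exists_pivot_basis V
  set T := pivotSet V with hT
  set w : Bits n := ∑ i ∈ T, a i • R i with hw
  have hwV : w ∈ V := Submodule.sum_mem _ fun i _ => Submodule.smul_mem _ _ (hRV i)
  have hwa : ∀ j ∈ T, w j = a j := fun j hj => by
    rw [hw, Finset.sum_apply, Finset.sum_eq_single j]
    · simp [hRp j hj j hj]
    · intro i hi hij
      simp [hRp i hi j hj, hij]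
    · exact fun hj' => absurd hj hj'
  set A : Finset (Fin n) := Finset.univ.filter fun i => (a + w) i = 1 with hAdef
  have hAmem : ∀ i, i ∈ A ↔ (a + w) i = 1 := fun i => by simp [hAdef]
  have hind : indicator A = a + w := by
    funext i
    rcases zmod_two_cases ((a + w) i) with h | h
    · rw [indicator, if_neg (by rw [hAmem, h]; exact zero_ne_one), h]
    · rw [indicator, if_pos ((hAmem i).2 h), h]
  have hoff : ∀ i ∈ T, (a + w) i = 0 := fun i hi => by
    rw [Pi.add_apply, hwa i hi, ZModModule.add_self]
  have hA : A ⊆ Tᶜ := fun i hi => by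
    rw [Finset.mem_compl]
    intro hiT
    have h1 := (hAmem i).1 hi
    rw [hoff i hiT] at h1
    exact zero_ne_one h1
  have hmem : ∀ x, x + indicator A ∈ V ↔ x + a ∈ V := fun x => by
    rw [hind, ← add_assoc, V.add_mem_iff_left hwV]
  have hq' : IsQuadratic fun v => q (v + (a + w)) := hq.comp_affine LinearMap.id (a + w)
  obtain ⟨b, E, hE⟩ := hq'.exists_expansion R
  -- The coefficient `b i` is `[i ∈ B] + 2 [i ∈ D]`.
  set B := T.filter fun i => b i = 1 ∨ b i = 3
  set D := T.filter fun i => b i = 2 ∨ b i = 3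
  set C := (pairs T).filter fun p => E p.1 p.2 = 1
  refine ⟨V, A, hA, B, Finset.filter_subset _ _, D, Finset.filter_subset _ _, C,
    Finset.filter_subset _ _, ?_⟩
  have hphase : ∀ x, x + a ∈ V → q x = q (a + w) + phaseForm B D C x := fun x hx => by
    have hxV : x + (a + w) ∈ V := by rwa [← hind, hmem]
    have hx1 : x = x + (a + w) + (a + w) := by
      rw [add_assoc x, ZModModule.add_self, add_zero]
    have hx2 : x + (a + w) = ∑ i ∈ T, x i • R i := by
      conv_lhs => rw [hRs _ hxV]
      refine Finset.sum_congr rfl fun i hi => ?_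
      rw [Pi.add_apply, hoff i hi, add_zero]
    have h1 := hE T x
    rw [← hx2, ← hx1, zero_add] at h1
    rw [h1, add_assoc]
    congr 1
    have hB : ∑ i ∈ B, lift (x i) = ∑ i ∈ T, if b i = 1 ∨ b i = 3 then lift (x i) else 0 :=
      Finset.sum_filter _ _
    have hD : ∑ i ∈ D, 2 * lift (x i) = ∑ i ∈ T, if b i = 2 ∨ b i = 3 then 2 * lift (x i) else 0 :=
      Finset.sum_filter _ _
    have hC : ∑ p ∈ C, 2 * lift (x p.1 * x p.2) =
        ∑ p ∈ pairs T, if E p.1 p.2 = 1 then 2 * lift (x p.1 * x p.2) else 0 :=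
      Finset.sum_filter _ _
    rw [phaseForm, hB, hD, hC, ← Finset.sum_add_distrib]
    congr 1
    · exact Finset.sum_congr rfl fun i _ => zmod_four_mul_lift _ _
    · refine Finset.sum_congr rfl fun p _ => ?_
      rcases zmod_two_cases (E p.1 p.2) with h | h <;> simp [h]
  obtain ⟨c', hc', hf'⟩ := exists_act_circuit V A B D C
  rw [prepared_eq_iff]
  refine ⟨c * phase (q (a + w)) / c', funext fun x => ?_⟩
  rw [Pi.smul_apply, smul_eq_mul]
  by_cases hx : x + a ∈ V
  · rw [(hf x).1 hx, (hf' x).1 ((hmem x).2 hx), hphase x hx, phase_add]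
    field_simp
  · rw [(hf x).2 hx, (hf' x).2 (fun h => hx ((hmem x).1 h)), mul_zero]

theorem mem_stabilizerStates_iff (s : PureState n) : s ∈ stabilizerStates n ↔
    ∃ V : Submodule (ZMod 2) (Bits n), ∃ A ⊆ (pivotSet V)ᶜ, ∃ B ⊆ pivotSet V, ∃ D ⊆ pivotSet V,
      ∃ C ⊆ pairs (pivotSet V), s = prepared (circuit V A B D C) := by
  constructor
  · rintro ⟨U, hU, rfl⟩
    exact (isStabVec_ketZero.act_clifford hU).exists_circuit
  · rintro ⟨V, A, _, B, _, D, _, C, hC, rfl⟩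
    exact ⟨_, circuit_mem V A B D hC, rfl⟩

theorem finite_stabilizerStates : (stabilizerStates n).Finite := by
  have hfin := Set.finite_range fun p : Submodule (ZMod 2) (Bits n) × Finset (Fin n) ×
    Finset (Fin n) × Finset (Fin n) × Finset (Fin n × Fin n) =>
      prepared (circuit p.1 p.2.1 p.2.2.1 p.2.2.2.1 p.2.2.2.2)
  refine hfin.subset fun s hs => ?_
  obtain ⟨V, A, _, B, _, D, _, C, _, rfl⟩ := (mem_stabilizerStates_iff s).1 hs
  exact ⟨(V, A, B, D, C), rfl⟩

/-! ### The number of subspaces and the weights -/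

theorem mem_subspaces {k : ℕ} {V : Submodule (ZMod 2) (Bits n)} :
    V ∈ subspaces n k ↔ Module.finrank (ZMod 2) V = k := by
  rw [subspaces, Set.Finite.mem_toFinset, Set.mem_ofPred_eq]

/-- The ordered bases of a subspace `V` of dimension `k`, seen inside the whole space. -/
noncomputable def basesEquiv {k : ℕ} (V : Submodule (ZMod 2) (Bits n))
    (hV : Module.finrank (ZMod 2) V = k) :
    {s : {s : Fin k → Bits n // LinearIndependent (ZMod 2) s} //
      Submodule.span (ZMod 2) (Set.range s.1) = V} ≃
    {s : Fin k → V // LinearIndependent (ZMod 2) s} where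
  toFun s := ⟨fun i => ⟨s.1.1 i, s.2.le (Submodule.subset_span ⟨i, rfl⟩)⟩,
    LinearIndependent.of_comp V.subtype s.1.2⟩
  invFun s := ⟨⟨fun i => s.1 i, s.2.map' V.subtype V.ker_subtype⟩, by
    have hli : LinearIndependent (ZMod 2) fun i => (s.1 i : Bits n) :=
      s.2.map' V.subtype V.ker_subtype
    refine Submodule.eq_of_le_of_finrank_eq (Submodule.span_le.2 ?_) ?_
    · rintro _ ⟨i, rfl⟩
      exact (s.1 i).2
    · rw [finrank_span_eq_card hli, Fintype.card_fin, hV]⟩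
  left_inv _ := rfl
  right_inv _ := rfl

/-- Counting the linearly independent families of `k` vectors by the subspace that they span. -/
theorem card_subspaces_mul {k : ℕ} (hk : k ≤ n) :
    (subspaces n k).card * ∏ i : Fin k, (2 ^ k - 2 ^ i.val) = ∏ i : Fin k, (2 ^ n - 2 ^ i.val) := by
  have h1 := card_linearIndependent (K := ZMod 2) (V := Bits n) (k := k)
    (by rw [Module.finrank_fin_fun]; exact hk)
  rw [Module.finrank_fin_fun, ZMod.card] at h1
  let span : {s : Fin k → Bits n // LinearIndependent (ZMod 2) s} → subspaces n k := fun s =>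
    ⟨Submodule.span (ZMod 2) (Set.range s.1), by
      rw [mem_subspaces, finrank_span_eq_card s.2, Fintype.card_fin]⟩
  have h2 : ∀ V : subspaces n k, Nat.card {s // span s = V} = ∏ i : Fin k, (2 ^ k - 2 ^ i.val) := by
    rintro ⟨V, hV⟩
    have hV' := mem_subspaces.1 hV
    have h3 := card_linearIndependent (K := ZMod 2) (V := V) (k := k) hV'.ge
    rw [hV', ZMod.card] at h3
    rw [← h3]
    exact Nat.card_congr
      ((Equiv.subtypeEquivRight fun s => Subtype.ext_iff).trans (basesEquiv V hV'))
  rw [← h1, ← Nat.card_congr (Equiv.sigmaFiberEquiv span), Nat.card_sigma,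
    Finset.sum_congr rfl fun V _ => h2 V, Finset.sum_const, Finset.card_univ, smul_eq_mul,
    Fintype.card_coe]

/-- The product `∏_{a=1}^m (1 - 2^(-a))`. -/
noncomputable def eulerProd (m : ℕ) : ℝ := ∏ a ∈ Finset.Icc 1 m, (1 - ((2 : ℝ) ^ a)⁻¹)

theorem eulerProd_succ (m : ℕ) :
    eulerProd (m + 1) = eulerProd m * (1 - ((2 : ℝ) ^ (m + 1))⁻¹) :=
  Finset.prod_Icc_succ_top (by omega) _

theorem eulerProd_ne_zero (m : ℕ) : eulerProd m ≠ 0 := by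
  refine Finset.prod_ne_zero_iff.2 fun a ha => ?_
  have h1 : (1 : ℝ) < 2 ^ a :=
    one_lt_pow₀ (by norm_num) (by have := (Finset.mem_Icc.1 ha).1; omega)
  exact (sub_pos.2 (inv_lt_one_of_one_lt₀ h1)).ne'

theorem prod_pow_sub_pow (k d : ℕ) :
    (∏ i ∈ Finset.range k, ((2 : ℝ) ^ (k + d) - 2 ^ i)) * eulerProd d =
      2 ^ ((k + d) * k) * eulerProd (k + d) := by
  induction k generalizing d with
  | zero => simp
  | succ k ih =>
    have h := ih (d + 1)
    rw [show k + 1 + d = k + (d + 1) by ring, Finset.prod_range_succ]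
    rw [eulerProd_succ] at h
    have h2 : (2 : ℝ) ^ (k + (d + 1)) - 2 ^ k =
        2 ^ (k + (d + 1)) * (1 - ((2 : ℝ) ^ (d + 1))⁻¹) := by
      rw [pow_add]; field_simp
    rw [h2, mul_add (k + (d + 1)) k 1, pow_add 2 ((k + (d + 1)) * k), mul_one]
    linear_combination 2 ^ (k + (d + 1)) * h

theorem prod_shifted (k d : ℕ) :
    (∏ a ∈ Finset.Icc 1 d, (1 - ((2 : ℝ) ^ (k + a))⁻¹)) * eulerProd k = eulerProd (k + d) := by
  induction d with
  | zero => simp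
  | succ d ih =>
    rw [Finset.prod_Icc_succ_top (by omega), ← add_assoc, eulerProd_succ, ← ih]
    ring

/-- The weight `η(d)` is, up to a power of two, the number of subspaces of codimension `d`. -/
theorem eta_mul (k d : ℕ) :
    eta (k + d) d * 2 ^ (d * (d + 1) / 2 + d * k) = (subspaces (k + d) k).card := by
  have heta : eta (k + d) d =
      ((2 : ℝ) ^ (d * (d + 1) / 2))⁻¹ * (eulerProd (k + d) / eulerProd k / eulerProd d) := by
    rw [eta, zpow_neg, zpow_natCast, Finset.prod_div_distrib, ← prod_shifted k d,
      mul_div_cancel_right₀ _ (eulerProd_ne_zero k), eulerProd]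
    congr 2
    · refine Finset.prod_congr rfl fun a _ => ?_
      rw [show ((d : ℤ) - (k + d : ℕ) - a) = -((k + a : ℕ) : ℤ) by push_cast; ring, zpow_neg,
        zpow_natCast]
    · refine Finset.prod_congr rfl fun a _ => ?_
      rw [zpow_neg, zpow_natCast]
  have hcast : ∀ m, k ≤ m → ((∏ i : Fin k, (2 ^ m - 2 ^ i.val) : ℕ) : ℝ) =
      ∏ i ∈ Finset.range k, ((2 : ℝ) ^ m - 2 ^ i) := fun m hm => by
    rw [Finset.prod_range, Nat.cast_prod]
    refine Finset.prod_congr rfl fun i _ => ?_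
    rw [Nat.cast_sub (Nat.pow_le_pow_right (by norm_num) (by omega))]
    push_cast
    rfl
  have hcard := congrArg (Nat.cast : ℕ → ℝ) (card_subspaces_mul (n := k + d) (k := k) (by omega))
  rw [Nat.cast_mul, hcast k le_rfl, hcast (k + d) (by omega)] at hcard
  have h1 := prod_pow_sub_pow k 0
  have h2 := prod_pow_sub_pow k d
  rw [add_zero, show eulerProd 0 = 1 from rfl, mul_one] at h1
  rw [← hcard, h1, add_mul, pow_add, mul_comm d k] at h2
  have h3 : ((subspaces (k + d) k).card : ℝ) * eulerProd k * eulerProd d =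
      2 ^ (k * d) * eulerProd (k + d) := by
    refine mul_left_cancel₀ (pow_ne_zero (k * k) (two_ne_zero (α := ℝ))) ?_
    linear_combination h2
  have hk := eulerProd_ne_zero k
  have hd := eulerProd_ne_zero d
  rw [heta, pow_add, mul_comm d k]
  field_simp
  linear_combination -h3

theorem card_pairs (T : Finset (Fin n)) : 2 * (pairs T).card + T.card = T.card * T.card := by
  rw [pairs]
  induction T using Finset.induction_on_max with
  | empty => simp
  | insert a s ha ih =>
    have has : a ∉ s := fun h => lt_irrefl _ (ha a h)
    obtain ⟨h1, h2⟩ := filter_lt_insert_max ha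
    rw [h1, Finset.card_union_of_disjoint h2,
      Finset.card_image_of_injective _ fun i j h => (Prod.mk.inj h).1,
      Finset.card_insert_of_notMem has]
    linarith

/-! ### The law of the output -/

/-- If only one value of the first random choice can lead to the outcome `b`, the probability of `b`
is a product. -/
theorem bind_apply_of_unique {α β : Type*} (p : PMF α) (f : α → PMF β) {a : α} {b : β}
    (h : ∀ a' ∈ p.support, b ∈ (f a').support → a' = a) : p.bind f b = p a * f a b := by
  rw [PMF.bind_apply, tsum_eq_single a]
  intro a' ha'
  by_contra hne
  obtain ⟨h1, h2⟩ := mul_ne_zero_iff.1 hne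
  exact ha' (h a' ((PMF.mem_support_iff _ _).2 h1) ((PMF.mem_support_iff _ _).2 h2))

/-- The definition with its nonemptiness proof stated as `Finset.Nonempty`, the form that the lemmas
on `PMF.uniformOfFinset` match. -/
theorem randomSubset_eq {α : Type} (A : Finset α) :
    randomSubset A = PMF.uniformOfFinset A.powerset A.powerset_nonempty := rfl

theorem mem_support_randomSubset {α : Type} {A B : Finset α} :
    B ∈ (randomSubset A).support ↔ B ⊆ A := by
  rw [randomSubset_eq, PMF.mem_support_uniformOfFinset_iff, Finset.mem_powerset]

theorem randomSubset_apply {α : Type} {A B : Finset α} (h : B ⊆ A) :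
    randomSubset A B = ((2 ^ A.card : ℕ) : ENNReal)⁻¹ := by
  rw [randomSubset_eq, PMF.uniformOfFinset_apply_of_mem _ (Finset.mem_powerset.2 h),
    Finset.card_powerset]

theorem sum_eta_pos (n : ℕ) : 0 < ∑ m ∈ Finset.range (n + 1), eta n m :=
  Finset.sum_pos (fun m hm => eta_pos (by simpa [Nat.lt_succ_iff] using hm)) (by simp)

theorem mem_support_lawP (d : Fin (n + 1)) : d ∈ (lawP n).support := by
  rw [PMF.mem_support_iff, lawP, PMF.ofFintype_apply]
  exact (ENNReal.ofReal_pos.2 (div_pos (eta_pos (Nat.lt_succ_iff.1 d.2)) (sum_eta_pos n))).ne'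

theorem finrank_le (V : Submodule (ZMod 2) (Bits n)) : Module.finrank (ZMod 2) V ≤ n := by
  simpa using Submodule.finrank_le V

theorem mem_support_outputLaw (s : PureState n) :
    s ∈ (outputLaw n).support ↔ s ∈ stabilizerStates n := by
  rw [mem_stabilizerStates_iff, outputLaw]
  simp only [PMF.mem_support_bind_iff, PMF.mem_support_uniformOfFinset_iff, mem_subspaces,
    mem_support_randomSubset, PMF.mem_support_pure_iff]
  constructor
  · rintro ⟨d, _, V, _, A, hA, B, hB, D, hD, C, hC, hs⟩
    exact ⟨V, A, hA, B, hB, D, hD, C, hC, hs⟩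
  · rintro ⟨V, A, hA, B, hB, D, hD, C, hC, hs⟩
    have hV := finrank_le V
    exact ⟨⟨n - Module.finrank (ZMod 2) V, by omega⟩, mem_support_lawP _, V, by dsimp only; omega,
      A, hA, B, hB, D, hD, C, hC, hs⟩

/-- All stabilizer states are equally likely. -/
theorem toReal_outputLaw {s : PureState n} (hs : s ∈ stabilizerStates n) :
    (outputLaw n s).toReal =
      (∑ m ∈ Finset.range (n + 1), eta n m)⁻¹ * ((2 : ℝ) ^ (n + n * (n + 1) / 2))⁻¹ := by
  obtain ⟨V, A, hA, B, hB, D, hD, C, hC, rfl⟩ := (mem_stabilizerStates_iff s).1 hs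
  have hVn := finrank_le V
  set k := Module.finrank (ZMod 2) V with hk
  obtain ⟨d, hd⟩ : ∃ d, n = k + d := ⟨n - k, by omega⟩
  have hVd : V ∈ subspaces n (n - d) := mem_subspaces.2 (by omega)
  have hval : outputLaw n (prepared (circuit V A B D C)) =
      lawP n ⟨d, by omega⟩ * (((subspaces n (n - d)).card : ENNReal)⁻¹ *
        (((2 ^ (pivotSet V)ᶜ.card : ℕ) : ENNReal)⁻¹ * (((2 ^ (pivotSet V).card : ℕ) : ENNReal)⁻¹ *
          (((2 ^ (pivotSet V).card : ℕ) : ENNReal)⁻¹ *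
            ((2 ^ (pairs (pivotSet V)).card : ℕ) : ENNReal)⁻¹)))) := by
    rw [outputLaw, bind_apply_of_unique (a := ⟨d, by omega⟩),
      bind_apply_of_unique (a := V), bind_apply_of_unique (a := A), bind_apply_of_unique (a := B),
      bind_apply_of_unique (a := D), bind_apply_of_unique (a := C),
      PMF.uniformOfFinset_apply_of_mem _ hVd, randomSubset_apply hA, randomSubset_apply hB,
      randomSubset_apply hD, randomSubset_apply hC, PMF.pure_apply, circuit, if_pos rfl, mul_one]
    all_goals
      simp only [PMF.mem_support_bind_iff, PMF.mem_support_uniformOfFinset_iff, mem_subspaces,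
        mem_support_randomSubset, PMF.mem_support_pure_iff]
    · intro C' hC' h
      exact (circuit_injective hA hB hD hC hA hB hD hC' h).2.2.2.2.symm
    · rintro D' hD' ⟨C', hC', h⟩
      exact (circuit_injective hA hB hD hC hA hB hD' hC' h).2.2.2.1.symm
    · rintro B' hB' ⟨D', hD', C', hC', h⟩
      exact (circuit_injective hA hB hD hC hA hB' hD' hC' h).2.2.1.symm
    · rintro A' hA' ⟨B', hB', D', hD', C', hC', h⟩
      exact (circuit_injective hA hB hD hC hA' hB' hD' hC' h).2.1.symm
    · rintro V' _ ⟨A', hA', B', hB', D', hD', C', hC', h⟩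
      exact (circuit_injective hA hB hD hC hA' hB' hD' hC' h).1.symm
    · rintro d' _ ⟨V', hV', A', hA', B', hB', D', hD', C', hC', h⟩
      obtain rfl := (circuit_injective hA hB hD hC hA' hB' hD' hC' h).1
      refine Fin.ext ?_
      have := d'.2
      dsimp only
      omega
  have hT : (pivotSet V).card = k := card_pivotSet V
  have hTc : (pivotSet V)ᶜ.card = d := by rw [Finset.card_compl, hT, Fintype.card_fin]; omega
  have hpairs := card_pairs (pivotSet V)
  rw [hT] at hpairs
  set c := (pairs (pivotSet V)).card
  have hsum := sum_eta_pos n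
  have heta_pos : 0 < eta n d := eta_pos (by omega)
  have hlaw : (lawP n ⟨d, by omega⟩).toReal = eta n d / ∑ m ∈ Finset.range (n + 1), eta n m := by
    rw [lawP, PMF.ofFintype_apply, ENNReal.toReal_ofReal (div_pos heta_pos hsum).le]
  have hcard : ((subspaces n (n - d)).card : ℝ) = eta n d * 2 ^ (d * (d + 1) / 2 + d * k) := by
    rw [show n - d = k by omega, hd, eta_mul]
  -- Cleared of the divisions by two, this is the expansion of `n * (n + 1)` for `n = k + d`.
  have hexp : n + n * (n + 1) / 2 = d * (d + 1) / 2 + d * k + d + k + k + c := by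
    obtain ⟨a, ha⟩ := Nat.even_mul_succ_self d
    obtain ⟨b, hb⟩ := Nat.even_mul_succ_self n
    have ha' : d * (d + 1) / 2 = a := by omega
    have hb' : n * (n + 1) / 2 = b := by omega
    rw [ha', hb']
    have hn : n * (n + 1) = k * k + 2 * (d * k) + d * (d + 1) + k := by rw [hd]; ring
    omega
  rw [hval]
  simp only [ENNReal.toReal_mul, ENNReal.toReal_inv, ENNReal.toReal_natCast, hlaw, hcard, hT, hTc,
    Nat.cast_pow, Nat.cast_ofNat, ENNReal.toReal_pow, ENNReal.toReal_ofNat]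
  rw [hexp]
  simp only [pow_add]
  have h1 := heta_pos.ne'
  have h2 := hsum.ne'
  field_simp

/-- A distribution that is constant on a finite set and vanishes outside it is uniform; the common
value need not be known. -/
theorem eq_uniformOfFinset {α : Type*} (p : PMF α) (S : Finset α) (hS : S.Nonempty)
    (hsupp : ∀ a, a ∈ p.support ↔ a ∈ S) (hconst : ∀ a ∈ S, ∀ b ∈ S, p a = p b) :
    p = PMF.uniformOfFinset S hS := by
  classical
  ext a
  rw [PMF.uniformOfFinset_apply]
  split_ifs with ha
  · have h1 := p.tsum_coe
    rw [tsum_eq_sum (s := S) fun b hb => (p.apply_eq_zero_iff b).2 fun h => hb ((hsupp b).1 h),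
      Finset.sum_congr rfl fun b hb => hconst b hb a ha, Finset.sum_const, nsmul_eq_mul] at h1
    exact ENNReal.eq_inv_of_mul_eq_one_left (by rwa [mul_comm])
  · exact (p.apply_eq_zero_iff a).2 fun h => ha ((hsupp a).1 h)

end RandomStab

theorem mainTheorem10 (n : ℕ) :
    ∃ (hfin : (RandomStab.stabilizerStates n).Finite) (hne : hfin.toFinset.Nonempty),
      RandomStab.outputLaw n = PMF.uniformOfFinset hfin.toFinset hne := by
  have hfin := RandomStab.finite_stabilizerStates (n := n)
  refine ⟨hfin, ⟨RandomStab.prepared 1, hfin.mem_toFinset.2 ⟨1, one_mem _, rfl⟩⟩, ?_⟩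
  refine RandomStab.eq_uniformOfFinset _ _ _ (fun s => ?_) fun s hs t ht => ?_
  · rw [hfin.mem_toFinset, RandomStab.mem_support_outputLaw]
  · rw [hfin.mem_toFinset] at hs ht
    rw [← ENNReal.toReal_eq_toReal_iff' (PMF.apply_ne_top _ _) (PMF.apply_ne_top _ _),
      RandomStab.toReal_outputLaw hs, RandomStab.toReal_outputLaw ht]
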